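/- \textbf{Setting.} Let $G=(V,E)$ be a graph with $n$ vertices, directed or undirected, without parallel edges and with positive edge weights (all equal to $1$ in the unweighted case). For positive integers $L,f$, an \emph{$(L,f)$-replacement path covering} (RPC) of $G$ is a family $\mathcal{G}$ of spanning subgraphs of $G$ that has, for every $F\subseteq E$ with $|F|\le f$, a subfamily $\mathcal{G}_F\subseteq\mathcal{G}$ such that (i) no subgraph in $\mathcal{G}_F$ contains an edge of $F$, and (ii) for all $s,t\in V$ for which some shortest (that is, minimum-weight) path from $s$ to $t$ in $G-F$ has at most $L$ edges, at least one subgraph in $\mathcal{G}_F$ contains such a path. The \emph{covering value} is $|\mathcal{G}|$. The \emph{query time} is the number of steps that a deterministic word RAM takes, in the worst case over $F$, to output (references to) the members of $\mathcal{G}_F$ when it is given $F$ and has read access to a data structure prepared from $G$, $L$ and $f$. This data structure stores the subgraphs in $\mathcal{G}$ (as adjacency matrices), its number $S$ of words is at most $n^2$ times the bound on the covering value that is stated below, and the word length is $O(\log(n+S))$. We write $\widetilde{O}(g)$ for $O(g\cdot\mathrm{polylog}(n))$. \textbf{Theorem.} Let $f=f(n)$ and $L=L(n)$ be positive integers. (1)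 If $f=o(\log L)$ as $n\to\infty$, then every $n$-vertex graph $G$ has a deterministic $(L,f)$-replacement path covering with covering value $\widetilde{O}(f L^{f+o(1)})$ and query time $\widetilde{O}(f^{5/2}L^{o(1)})$, and for every $F$ the computed subfamily $\mathcal{G}_F$ has size $\widetilde{O}(f L^{o(1)})$. (2) If $f=o(\log n)$ as $n\to\infty$, then every $n$-vertex graph $G$ has a deterministic $(L,f)$-replacement path covering with covering value $L^{f}n^{o(1)}$, query time $n^{o(1)}$, and $|\mathcal{G}_F|\le n^{o(1)}$ for every $F$. The query program and the constants hidden in $\widetilde{O}$ and in the word length are universal, and the $o(1)$ terms depend only on $n$ and the functions $f,L$, not on $G$. -/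

import Mathlib

open Filter Topology Asymptotics

/-! ## Graphs, paths and replacement path coverings -/

/-- Graphs may be directed or undirected. -/
inductive EdgeKind where
  | directed
  | undirected

/-- The possible edges on the vertex set `Fin n`: ordered pairs of vertices in a directed graph,
unordered pairs in an undirected one. -/
def Edge (k : EdgeKind) (n : ℕ) : Type :=
  match k with
  | .directed => Fin n × Fin n
  | .undirected => Sym2 (Fin n)

/-- The edge along which one travels from `u` to `v`. In the undirected case
`link u v = link v u`. -/
def Edge.link {k : EdgeKind} {n : ℕ} (u v : Fin n) : Edge k n :=
  match k with
  | .directed => (u, v)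
  | .undirected => s(u, v)

/-- A graph with `n` vertices, directed or undirected, with positive edge weights
(constant weight `1` is the unweighted case). There are no parallel edges. -/
structure WGraph (k : EdgeKind) (n : ℕ) where
  edges : Set (Edge k n)
  weight : Edge k n → ℝ
  weight_pos : ∀ e ∈ edges, 0 < weight e

/-- The edges of the walk that starts in `s` and then visits the vertices of the list in order;
the number of edges is the length of the list. -/
def walkEdges {k : EdgeKind} {n : ℕ} : Fin n → List (Fin n) → List (Edge k n)
  | _, [] => []
  | s, v :: p => Edge.link s v :: walkEdges v p

/-- The vertex sequence `s :: p` is a path from `s` to `t` that uses only edges of `H`. -/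
structure IsPath {k : EdgeKind} {n : ℕ} (H : Set (Edge k n)) (s t : Fin n)
    (p : List (Fin n)) : Prop where
  nodup : (s :: p).Nodup
  last_eq : (s :: p).getLast (List.cons_ne_nil s p) = t
  edges_mem : ∀ e ∈ walkEdges s p, e ∈ H

/-- The total weight of the walk `s :: p`. -/
noncomputable def WGraph.pathWeight {k : EdgeKind} {n : ℕ} (G : WGraph k n) (s : Fin n)
    (p : List (Fin n)) : ℝ :=
  ((walkEdges s p).map G.weight).sum

/-- `s :: p` is a shortest path from `s` to `t` in the spanning subgraph with edge set `H`. -/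
def WGraph.IsShortestPath {k : EdgeKind} {n : ℕ} (G : WGraph k n) (H : Set (Edge k n))
    (s t : Fin n) (p : List (Fin n)) : Prop :=
  IsPath H s t p ∧ ∀ q, IsPath H s t q → G.pathWeight s p ≤ G.pathWeight s q

/-- An `(L, f)`-replacement path covering of `G`: a family of `size` many spanning subgraphs (each
given by its edge set) with a subfamily (given by its indices) for every admissible failure set.
The covering value is `size`. -/
structure RPC {k : EdgeKind} {n : ℕ} (G : WGraph k n) (L f : ℕ) where
  size : ℕ
  graph : Fin size → Set (Edge k n)
  graph_subset : ∀ i, graph i ⊆ G.edges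
  /-- the subfamily for the failure set `F`; only its values on sets of at most `f` edges
  of `G` matter -/
  sub : Finset (Edge k n) → Finset (Fin size)
  avoids : ∀ F : Finset (Edge k n), (F : Set (Edge k n)) ⊆ G.edges → F.card ≤ f →
    ∀ i ∈ sub F, ∀ e ∈ F, e ∉ graph i
  covers : ∀ F : Finset (Edge k n), (F : Set (Edge k n)) ⊆ G.edges → F.card ≤ f →
    ∀ s t : Fin n,
      (∃ p, G.IsShortestPath (G.edges \ (F : Set (Edge k n))) s t p ∧ p.length ≤ L) →
      ∃ i ∈ sub F, ∃ p, G.IsShortestPath (G.edges \ (F : Set (Edge k n))) s t p ∧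
        p.length ≤ L ∧ IsPath (graph i) s t p

/-! ## A word RAM with a step count -/

/-- Elementary instructions, on registers numbered by natural numbers. Every register and every
memory cell holds a word of `w` bits, that is, a number below `2 ^ w`. -/
inductive Instr where
  /-- `r := c` -/
  | const (r c : ℕ)
  /-- `r := a + b` modulo `2 ^ w` -/
  | add (r a b : ℕ)
  /-- `r := a - b`, cut off at `0` -/
  | sub (r a b : ℕ)
  /-- `r := a * b` modulo `2 ^ w` -/
  | mul (r a b : ℕ)
  /-- `r := data[a]`, from the read-only data structure -/
  | readData (r a : ℕ)
  /-- `r := query[a]`, from the read-only query input -/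
  | readQuery (r a : ℕ)
  /-- `r := mem[a]`, from the working memory -/
  | load (r a : ℕ)
  /-- `mem[a] := r` -/
  | store (a r : ℕ)
  /-- append the content of `r` to the output -/
  | emit (r : ℕ)

/-- Programs: control flow on top of the elementary instructions. -/
inductive Prog where
  | instr (i : Instr)
  | seq (p q : Prog)
  /-- if register `a` is smaller than register `b` then `p` else `q` -/
  | ifLt (a b : ℕ) (p q : Prog)
  /-- while register `a` is smaller than register `b` do `p` -/
  | whileLt (a b : ℕ) (p : Prog)

/-- Registers, working memory, and the output written so far. -/
structure RamState where
  reg : ℕ → ℕ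
  mem : ℕ → ℕ
  out : List ℕ

/-- Write `x` into register `r`. -/
def RamState.set (σ : RamState) (r x : ℕ) : RamState :=
  { σ with reg := Function.update σ.reg r x }

/-- The effect of an elementary instruction, for word length `w`. -/
def Instr.run (w : ℕ) (data query : List ℕ) (σ : RamState) : Instr → RamState
  | .const r c => σ.set r (c % 2 ^ w)
  | .add r a b => σ.set r ((σ.reg a + σ.reg b) % 2 ^ w)
  | .sub r a b => σ.set r (σ.reg a - σ.reg b)
  | .mul r a b => σ.set r (σ.reg a * σ.reg b % 2 ^ w)
  | .readData r a => σ.set r (data.getD (σ.reg a) 0)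
  | .readQuery r a => σ.set r (query.getD (σ.reg a) 0)
  | .load r a => σ.set r (σ.mem (σ.reg a))
  | .store a r => { σ with mem := Function.update σ.mem (σ.reg a) (σ.reg r) }
  | .emit r => { σ with out := σ.out ++ [σ.reg r] }

/-- `Exec w data query P σ σ' t`: started in state `σ`, the program `P` halts in state `σ'`
after exactly `t` steps. Every elementary instruction and every test counts as one step. -/
inductive Exec (w : ℕ) (data query : List ℕ) : Prog → RamState → RamState → ℕ → Prop where
  | instr (i : Instr) (σ : RamState) : Exec w data query (.instr i) σ (i.run w data query σ) 1
  | seq {P Q : Prog} {σ₁ σ₂ σ₃ : RamState} {t₁ t₂ : ℕ} :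
      Exec w data query P σ₁ σ₂ t₁ → Exec w data query Q σ₂ σ₃ t₂ →
      Exec w data query (.seq P Q) σ₁ σ₃ (t₁ + t₂)
  | ifTrue {a b : ℕ} {P Q : Prog} {σ σ' : RamState} {t : ℕ} :
      σ.reg a < σ.reg b → Exec w data query P σ σ' t →
      Exec w data query (.ifLt a b P Q) σ σ' (t + 1)
  | ifFalse {a b : ℕ} {P Q : Prog} {σ σ' : RamState} {t : ℕ} :
      ¬ σ.reg a < σ.reg b → Exec w data query Q σ σ' t →
      Exec w data query (.ifLt a b P Q) σ σ' (t + 1)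
  | whileTrue {a b : ℕ} {P : Prog} {σ₁ σ₂ σ₃ : RamState} {t₁ t₂ : ℕ} :
      σ₁.reg a < σ₁.reg b → Exec w data query P σ₁ σ₂ t₁ →
      Exec w data query (.whileLt a b P) σ₂ σ₃ t₂ →
      Exec w data query (.whileLt a b P) σ₁ σ₃ (t₁ + t₂ + 1)
  | whileFalse {a b : ℕ} {P : Prog} {σ : RamState} :
      ¬ σ.reg a < σ.reg b → Exec w data query (.whileLt a b P) σ σ 1

/-- The machine is deterministic: final state, output and number of steps are determined by
the program, the data structure, the query and the initial state. -/
theorem Exec.deterministic {w : ℕ} {data query : List ℕ} {P : Prog} {σ σ₁ : RamState} {t₁ : ℕ}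
    (h₁ : Exec w data query P σ σ₁ t₁) :
    ∀ {σ₂ : RamState} {t₂ : ℕ}, Exec w data query P σ σ₂ t₂ → σ₁ = σ₂ ∧ t₁ = t₂ := by
  induction h₁ with
  | instr i σ => intro σ₂ t₂ h; cases h; exact ⟨rfl, rfl⟩
  | seq _ _ ih₁ ih₂ =>
    intro σ₂ t₂ h
    cases h with
    | seq g₁ g₂ =>
      obtain ⟨rfl, rfl⟩ := ih₁ g₁
      obtain ⟨rfl, rfl⟩ := ih₂ g₂
      exact ⟨rfl, rfl⟩
  | ifTrue hc _ ih =>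
    intro σ₂ t₂ h
    cases h with
    | ifTrue _ g => obtain ⟨rfl, rfl⟩ := ih g; exact ⟨rfl, rfl⟩
    | ifFalse hn _ => exact absurd hc hn
  | ifFalse hc _ ih =>
    intro σ₂ t₂ h
    cases h with
    | ifFalse _ g => obtain ⟨rfl, rfl⟩ := ih g; exact ⟨rfl, rfl⟩
    | ifTrue hn _ => exact absurd hn hc
  | whileTrue hc _ _ ih₁ ih₂ =>
    intro σ₂ t₂ h
    cases h with
    | whileTrue _ g₁ g₂ =>
      obtain ⟨rfl, rfl⟩ := ih₁ g₁
      obtain ⟨rfl, rfl⟩ := ih₂ g₂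
      exact ⟨rfl, rfl⟩
    | whileFalse hn => exact absurd hc hn
  | whileFalse hc =>
    intro σ₂ t₂ h
    cases h with
    | whileFalse _ => exact ⟨rfl, rfl⟩
    | whileTrue hn _ _ => exact absurd hn hc

/-! ## Answering queries -/

/-- The adjacency matrix of the spanning subgraph `H` is stored in `data`, row by row, starting at
address `a`. -/
def StoredAt {k : EdgeKind} {n : ℕ} (data : List ℕ) (a : ℕ) (H : Set (Edge k n)) : Prop :=
  a + n ^ 2 ≤ data.length ∧
    ∀ u v : Fin n, (Edge.link u v : Edge k n) ∈ H ↔ data.getD (a + (u : ℕ) * n + (v : ℕ)) 0 = 1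

/-- A query: the failing edges, each written as two words, its endpoints. -/
def queryWords {n : ℕ} (q : List (Fin n × Fin n)) : List ℕ :=
  q.flatMap fun e => [(e.1 : ℕ), (e.2 : ℕ)]

/-- At the start of a query, register `0` holds the number of failing edges; everything else
is `0`. -/
def startState (m : ℕ) : RamState where
  reg := Function.update (fun _ => 0) 0 m
  mem := fun _ => 0
  out := []

/-- With words of `w` bits and the data structure `data`, in which the `i`-th subgraph is stored at
address `loc i`, the program `P` answers every query `F` within `T` steps, whatever the order of
the failing edges (and of the two endpoints of an undirected one) in the input. The answer consists
of the addresses of the members of `𝒢_F`, each listed once. -/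
def RPC.Answers {k : EdgeKind} {n : ℕ} {G : WGraph k n} {L f : ℕ} (C : RPC G L f) (P : Prog)
    (w : ℕ) (data : List ℕ) (loc : Fin C.size → ℕ) (T : ℝ) : Prop :=
  n ^ 2 < 2 ^ w ∧ (∀ x ∈ data, x < 2 ^ w) ∧ (∀ i, StoredAt data (loc i) (C.graph i)) ∧
  ∀ F : Finset (Edge k n), (F : Set (Edge k n)) ⊆ G.edges → F.card ≤ f →
    ∀ q : List (Fin n × Fin n),
      (q.map fun e => (Edge.link e.1 e.2 : Edge k n)).Nodup →
      (∀ e : Edge k n, e ∈ (q.map fun e => (Edge.link e.1 e.2 : Edge k n)) ↔ e ∈ F) →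
      ∃ (ids : List (Fin C.size)) (σ : RamState) (t : ℕ),
        ids.Nodup ∧ (∀ i, i ∈ ids ↔ i ∈ C.sub F) ∧
        Exec w data (queryWords q) P (startState q.length) σ t ∧
        σ.out = ids.map loc ∧ (t : ℝ) ≤ T

/-- `G` has an `(L, f)`-replacement path covering with covering value at most `cov`, whose
subfamilies have at most `sz` members and are computed by `P` within `qt` steps from a data
structure of at most `cov * n ^ 2` words, which is about what the adjacency matrices of `cov` many
subgraphs take. The word length is `O(log (n + data.length))`, with factor `c`. -/
def HasCovering {k : EdgeKind} {n : ℕ} (G : WGraph k n) (L f : ℕ) (P : Prog) (c : ℕ)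
    (cov qt sz : ℝ) : Prop :=
  ∃ (C : RPC G L f) (w : ℕ) (data : List ℕ) (loc : Fin C.size → ℕ),
    (C.size : ℝ) ≤ cov ∧
    (∀ F : Finset (Edge k n), (F : Set (Edge k n)) ⊆ G.edges → F.card ≤ f →
      ((C.sub F).card : ℝ) ≤ sz) ∧
    (data.length : ℝ) ≤ cov * (n : ℝ) ^ 2 ∧
    2 ^ w ≤ (n + data.length) ^ c ∧
    C.Answers P w data loc qt

/-! Colour coding with digits. Put `B = 2 * L` and let `φ` assign to every edge a position in `Fin
f` and a digit in `Fin B`. Graph number `x` of `φ` drops the edges whose digit equals the base-`B`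
digit of `x` at their position. For a failure set `F`, the number to look at is `edgeCode φ F`, the
sum of the contributions of its edges.

If the positions are distinct on `F`, this number has the digit of each `e ∈ F` at the position of
`e`, so its graph loses all of `F` (`removed_edgeCode`). An edge outside `F` has a digit that does
not influence the code, so it is dropped with probability at most `1 / (2 * L)`; by a union bound, a
fixed path of at most `L` edges in `G - F` survives with probability at least `1 / 2`. Positions are
distinct on `F` with probability at least `f! / f ^ f ≥ exp (-f)`. So a uniformly random `φ` serves
a given triple `(F, s, t)` with probability at least `exp (-f) / 2` (`card_separates_ge`). There are
at most `n ^ (5 * f)` triples, hence `m = O(f * exp f * log n)` functions, chosen greedily, serve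
them all (`exists_satisfying_all`).

Queries are fast because the code is additive: for each function, sum at most `f` entries of a table
of edge codes, go to the matrix with that number, and output it if its entries at the failing edges
sum to `0`. This test replaces any check that positions are distinct. Each function yields at most
one graph and costs `O(f)` steps.

What remains is the loss of `exp (O(f)) * log n`: the exponential is `L ^ o(1)` if `f = o(log L)`,
and the whole factor is `n ^ o(1)` if `f = o(log n)`. -/

/-! ### Edge codes and the success probability of a random function -/

section Codes

variable {E : Type*} {f B : ℕ}

/-- The number whose base-`B` digit at position `(φ e).1` is `(φ e).2`, summed over `e ∈ F`. -/
def edgeCode (φ : E → Fin f × Fin B) (F : Finset E) : ℕ :=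
  ∑ e ∈ F, ((φ e).2 : ℕ) * B ^ ((φ e).1 : ℕ)

/-- The edge `e` is removed in the graph with number `x`. -/
def Removed (φ : E → Fin f × Fin B) (x : ℕ) (e : E) : Prop :=
  x / B ^ ((φ e).1 : ℕ) % B = ((φ e).2 : ℕ)

/-- Positions may coincide on `F`, in which case digits add up and carry. The bound covers this too,
so the code is always a legitimate graph number and the query program need not recognise the bad
case. -/
theorem edgeCode_le (φ : E → Fin f × Fin B) {F : Finset E} (hF : F.card ≤ f) :
    edgeCode φ F ≤ f * B ^ f := by
  refine (Finset.sum_le_card_nsmul _ _ (B ^ f) fun e _ => ?_).trans ?_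
  · have h1 := (φ e).2.2
    have h2 := (φ e).1.2
    calc ((φ e).2 : ℕ) * B ^ ((φ e).1 : ℕ) ≤ B * B ^ ((φ e).1 : ℕ) := by gcongr
      _ = B ^ ((φ e).1 + 1 : ℕ) := by ring
      _ ≤ B ^ f := Nat.pow_le_pow_right (by omega) h2
  · simpa using Nat.mul_le_mul_right _ hF

theorem removed_edgeCode (φ : E → Fin f × Fin B) {F : Finset E}
    (hF : Set.InjOn (fun e => (φ e).1) F) {e : E} (he : e ∈ F) :
    Removed φ (edgeCode φ F) e := by
  classical
  have hB : 0 < B := (φ e).2.pos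
  -- The digits of the code: positions that no edge of `F` occupies carry `0`.
  let y : Fin f → Fin B := fun j =>
    if h : ∃ a ∈ F, (φ a).1 = j then (φ h.choose).2 else ⟨0, hB⟩
  have hy : ∀ a ∈ F, y (φ a).1 = (φ a).2 := by
    intro a ha
    have h : ∃ b ∈ F, (φ b).1 = (φ a).1 := ⟨a, ha, rfl⟩
    have h2 := h.choose_spec
    have h3 : h.choose = a := hF h2.1 ha h2.2
    simp only [y, dif_pos h, h3]
  have hc : edgeCode φ F = (finFunctionFinEquiv y : ℕ) := by
    rw [finFunctionFinEquiv_apply, edgeCode,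
      ← Finset.sum_subset (Finset.subset_univ (F.image fun e => (φ e).1)), Finset.sum_image hF]
    · exact Finset.sum_congr rfl fun a ha => by rw [hy a ha]
    · intro j _ hj
      have h : ¬ ∃ a ∈ F, (φ a).1 = j := by simpa using hj
      simp [y, dif_neg h]
  have := finFunctionFinEquiv_symm_apply_val (finFunctionFinEquiv y) (φ e).1
  rw [Equiv.symm_apply_apply, hy e he] at this
  rw [Removed, hc, this]

variable [Fintype E] [DecidableEq E]

open Classical in
/-- Functions whose first component is injective on `F`. -/
noncomputable def colourings (f B : ℕ) (F : Finset E) : Finset (E → Fin f × Fin B) :=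
  Finset.univ.filter fun φ => Set.InjOn (fun e => (φ e).1) F

theorem mem_colourings {F : Finset E} {φ : E → Fin f × Fin B} :
    φ ∈ colourings f B F ↔ Set.InjOn (fun e => (φ e).1) F := by
  simp [colourings]

open Classical in
-- Double counting: a colouring of `F` together with an unused position for `e` turns into a
-- colouring of `insert e F`. Recording the old position of `e` makes this reversible, which costs
-- the factor `f`.
theorem card_colourings_insert {F : Finset E} {e : E} (he : e ∉ F) :
    (f - F.card) * (colourings f B F).card ≤ f * (colourings f B (insert e F)).card := by
  let S : Finset (Σ _ : E → Fin f × Fin B, Fin f) :=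
    (colourings f B F).sigma fun φ => Finset.univ \ F.image fun a => (φ a).1
  have hS : S.card = (f - F.card) * (colourings f B F).card := by
    rw [Finset.card_sigma, Finset.sum_congr rfl (g := fun _ => f - F.card), Finset.sum_const,
      smul_eq_mul, mul_comm]
    intro φ hφ
    rw [Finset.card_sdiff_of_subset (Finset.subset_univ _),
      Finset.card_image_of_injOn (mem_colourings.1 hφ)]
    simp
  have hT : (colourings f B (insert e F) ×ˢ (Finset.univ : Finset (Fin f))).card
      = f * (colourings f B (insert e F)).card := by
    simp [mul_comm]
  rw [← hS, ← hT]
  refine Finset.card_le_card_of_injOn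
    (fun p => (Function.update p.1 e (p.2, (p.1 e).2), (p.1 e).1)) ?_ ?_
  · rintro ⟨φ, c⟩ h
    simp only [S, Finset.coe_sigma, Set.mem_sigma_iff, Finset.mem_coe, mem_colourings,
      Finset.mem_sdiff, Finset.mem_image, not_exists, not_and] at h
    simp only [Finset.coe_product, Set.mem_prod, Finset.mem_coe, mem_colourings,
      Finset.mem_univ, and_true]
    have hne : ∀ a ∈ F, a ≠ e := fun a ha h => he (h ▸ ha)
    rw [Finset.coe_insert, Set.injOn_insert (by simpa using he)]
    constructor
    · intro a ha b hb hab
      have ha' := hne a ha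
      have hb' := hne b hb
      exact h.1 ha hb (by simpa [Function.update_of_ne, ha', hb'] using hab)
    · rintro ⟨a, ha, hab⟩
      refine h.2.2 a ha ?_
      simpa [Function.update_of_ne, hne a ha] using hab
  · rintro ⟨φ, c⟩ _ ⟨ψ, d⟩ _ h
    simp only [Prod.mk.injEq] at h
    have h1 := congrFun h.1 e
    simp only [Function.update_self, Prod.mk.injEq] at h1
    have : φ = ψ := by
      funext a
      by_cases ha : a = e
      · subst ha; exact Prod.ext h.2 h1.2
      · simpa [Function.update_of_ne, ha] using congrFun h.1 a
    subst this
    rw [h1.1]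

theorem descFactorial_mul_card_le (F : Finset E) :
    f.descFactorial F.card * Fintype.card (E → Fin f × Fin B)
      ≤ f ^ F.card * (colourings f B F).card := by
  induction F using Finset.induction_on with
  | empty => simp [colourings]
  | insert e F he ih =>
    rw [Finset.card_insert_of_notMem he, Nat.descFactorial_succ]
    calc (f - F.card) * f.descFactorial F.card * Fintype.card (E → Fin f × Fin B)
        ≤ (f - F.card) * (f ^ F.card * (colourings f B F).card) := by
          rw [mul_assoc]; gcongr
      _ = f ^ F.card * ((f - F.card) * (colourings f B F).card) := by ring
      _ ≤ f ^ F.card * (f * (colourings f B (insert e F)).card) :=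
          Nat.mul_le_mul_left _ (card_colourings_insert he)
      _ = _ := by ring

theorem factorial_mul_card_le {F : Finset E} (hF : F.card ≤ f) :
    f.factorial * Fintype.card (E → Fin f × Fin B) ≤ f ^ f * (colourings f B F).card := by
  calc f.factorial * Fintype.card (E → Fin f × Fin B)
      = (f - F.card).factorial * (f.descFactorial F.card * Fintype.card (E → Fin f × Fin B)) := by
        rw [← mul_assoc, Nat.factorial_mul_descFactorial hF]
    _ ≤ f ^ (f - F.card) * (f ^ F.card * (colourings f B F).card) := by
        refine Nat.mul_le_mul ?_ (descFactorial_mul_card_le F)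
        exact (Nat.factorial_le_pow _).trans (Nat.pow_le_pow_left (Nat.sub_le _ _) _)
    _ = f ^ f * (colourings f B F).card := by
        rw [← mul_assoc, ← pow_add, Nat.sub_add_cancel hF]

/-- The graph of `φ` with number `edgeCode φ F` avoids `F` and keeps `P`. -/
def Separates (F P : Finset E) (φ : E → Fin f × Fin B) : Prop :=
  (∀ e ∈ F, Removed φ (edgeCode φ F) e) ∧ ∀ e ∈ P, ¬ Removed φ (edgeCode φ F) e

open Classical in
-- As `e ∉ F`, the code ignores `φ e`, so exactly one digit of `e` gets it removed. Overwriting that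
-- digit by an arbitrary one is therefore injective.
theorem card_removed_mul_le {F : Finset E} {e : E} (he : e ∉ F) :
    ((colourings f B F).filter fun φ => Removed φ (edgeCode φ F) e).card * B
      ≤ (colourings f B F).card := by
  have hT : (((colourings f B F).filter fun φ => Removed φ (edgeCode φ F) e) ×ˢ
      (Finset.univ : Finset (Fin B))).card = 
      ((colourings f B F).filter fun φ => Removed φ (edgeCode φ F) e).card * B := by
    simp
  rw [← hT]
  have hne : ∀ a ∈ F, a ≠ e := fun a ha h => he (h ▸ ha)
  have hcode : ∀ (φ : E → Fin f × Fin B) (x), edgeCode (Function.update φ e x) F = edgeCode φ F :=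
    fun φ x => Finset.sum_congr rfl fun a ha => by rw [Function.update_of_ne (hne a ha)]
  refine Finset.card_le_card_of_injOn
    (fun p => Function.update p.1 e ((p.1 e).1, p.2)) ?_ ?_
  · rintro ⟨φ, c⟩ h
    simp only [Finset.coe_product, Set.mem_prod, Finset.mem_coe, Finset.mem_filter,
      mem_colourings] at h ⊢
    intro a ha b hb hab
    have ha' := hne a ha
    have hb' := hne b hb
    exact h.1.1 ha hb (by simpa [Function.update_of_ne, ha', hb'] using hab)
  · rintro ⟨φ, c⟩ h ⟨ψ, d⟩ h' hh
    simp only [Finset.coe_product, Set.mem_prod, Finset.mem_coe, Finset.mem_filter] at h h'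
    simp only at hh
    have h1 := congrFun hh e
    simp only [Function.update_self, Prod.mk.injEq] at h1
    have h2 : edgeCode φ F = edgeCode ψ F := by
      rw [← hcode φ, hh, hcode]
    have h3 := h.1.2
    have h4 := h'.1.2
    rw [Removed, h2, h1.1] at h3
    rw [Removed] at h4
    have : φ = ψ := by
      funext a
      by_cases ha : a = e
      · subst ha; exact Prod.ext h1.1 (Fin.ext (h3.symm.trans h4))
      · simpa [Function.update_of_ne, ha] using congrFun hh a
    rw [this, h1.2]

open Classical in
theorem card_colourings_le_card_separates {L : ℕ} (hL : 0 < L) {F P : Finset E}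
    (hP : P.card ≤ L) (hd : Disjoint F P) :
    (colourings f (2 * L) F).card ≤
      2 * (Finset.univ.filter fun φ : E → Fin f × Fin (2 * L) => Separates F P φ).card := by
  set C := colourings f (2 * L) F
  set S := Finset.univ.filter fun φ : E → Fin f × Fin (2 * L) => Separates F P φ
  set R : E → Finset (E → Fin f × Fin (2 * L)) := fun e =>
    C.filter fun φ => Removed φ (edgeCode φ F) e
  -- Once positions are distinct on `F`, the only possible failure is the removal of an edge of `P`.
  have hsub : C ⊆ S ∪ P.biUnion R := by
    intro φ hφ
    by_cases h : ∃ e ∈ P, Removed φ (edgeCode φ F) e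
    · obtain ⟨e, he, hr⟩ := h
      exact Finset.mem_union_right _
        (Finset.mem_biUnion.2 ⟨e, he, Finset.mem_filter.2 ⟨hφ, hr⟩⟩)
    · push Not at h
      refine Finset.mem_union_left _ (Finset.mem_filter.2 ⟨Finset.mem_univ _, ?_, h⟩)
      exact fun e he => removed_edgeCode φ (mem_colourings.1 hφ) he
  have h1 : C.card ≤ S.card + ∑ e ∈ P, (R e).card :=
    (Finset.card_le_card hsub).trans
      ((Finset.card_union_le _ _).trans (Nat.add_le_add_left Finset.card_biUnion_le _))
  have h2 : (∑ e ∈ P, (R e).card) * (2 * L) ≤ L * C.card := by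
    rw [Finset.sum_mul]
    refine (Finset.sum_le_card_nsmul _ _ C.card fun e he => ?_).trans ?_
    · exact card_removed_mul_le (Finset.disjoint_right.1 hd he)
    · simpa using Nat.mul_le_mul_right _ hP
  have h3 : (∑ e ∈ P, (R e).card) * 2 ≤ C.card := by
    refine Nat.le_of_mul_le_mul_left ?_ hL
    calc L * ((∑ e ∈ P, (R e).card) * 2) = (∑ e ∈ P, (R e).card) * (2 * L) := by ring
      _ ≤ _ := h2
  omega

open Classical in
/-- A uniformly random function separates with probability at least `exp (-f) / 2`. -/
theorem card_separates_ge {L : ℕ} (hL : 0 < L) {F P : Finset E} (hF : F.card ≤ f)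
    (hP : P.card ≤ L) (hd : Disjoint F P) :
    Real.exp (-f) / 2 * (Fintype.card (E → Fin f × Fin (2 * L)) : ℝ) ≤
      ((Finset.univ.filter fun φ : E → Fin f × Fin (2 * L) => Separates F P φ).card : ℝ) := by
  have h1 := factorial_mul_card_le (B := 2 * L) hF
  have h2 := card_colourings_le_card_separates (f := f) hL hP hd
  set N := Fintype.card (E → Fin f × Fin (2 * L))
  set C := (colourings f (2 * L) F).card
  set S := (Finset.univ.filter fun φ : E → Fin f × Fin (2 * L) => Separates F P φ).card
  have h1' : (f.factorial : ℝ) * N ≤ (f : ℝ) ^ f * C := by exact_mod_cast h1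
  have h2' : (C : ℝ) ≤ 2 * S := by exact_mod_cast h2
  -- One term of the exponential series; it replaces Stirling's formula.
  have h3 : (f : ℝ) ^ f / f.factorial ≤ Real.exp f :=
    Real.pow_div_factorial_le_exp f (by positivity) f
  have hfac : (0 : ℝ) < f.factorial := by exact_mod_cast f.factorial_pos
  rw [div_le_iff₀ hfac] at h3
  have h4 : (f.factorial : ℝ) * N ≤ f.factorial * (Real.exp f * C) := by
    calc (f.factorial : ℝ) * N ≤ (f : ℝ) ^ f * C := h1'
      _ ≤ Real.exp f * f.factorial * C := by gcongr
      _ = _ := by ring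
  have h5 : (N : ℝ) ≤ Real.exp f * C := le_of_mul_le_mul_left h4 hfac
  rw [Real.exp_neg]
  have h6 := Real.exp_pos f
  rw [div_mul_eq_mul_div, inv_mul_eq_div, div_div, div_le_iff₀ (by positivity)]
  nlinarith

end Codes

/-! ### Greedy derandomisation and the number of failure sets -/

section Greedy

variable {ι Ω : Type*} [Fintype Ω]

open Classical in
-- Averaging over `ω`: some choice leaves no more constraints unsatisfied than the mean does.
theorem exists_satisfying_many {R : ι → Ω → Prop} {p : ℝ}
    (hR : ∀ c, p * Fintype.card Ω ≤ (Finset.univ.filter (R c)).card) [Nonempty Ω]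
    (S : Finset ι) : ∃ ω, ((S.filter fun c => ¬ R c ω).card : ℝ) ≤ (1 - p) * S.card := by
  by_contra! h
  have h1 : ∑ ω : Ω, (1 - p) * (S.card : ℝ) < ∑ ω : Ω, ((S.filter fun c => ¬ R c ω).card : ℝ) :=
    Finset.sum_lt_sum_of_nonempty Finset.univ_nonempty fun ω _ => h ω
  have h2 : ∑ ω : Ω, ((S.filter fun c => ¬ R c ω).card : ℝ)
      = ∑ c ∈ S, ((Finset.univ.filter fun ω => ¬ R c ω).card : ℝ) := by
    exact_mod_cast Finset.sum_card_bipartiteAbove_eq_sum_card_bipartiteBelow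
      (s := (Finset.univ : Finset Ω)) (t := S) (fun ω c => ¬ R c ω)
  have h3 : ∀ c ∈ S, ((Finset.univ.filter fun ω => ¬ R c ω).card : ℝ)
      ≤ (1 - p) * Fintype.card Ω := by
    intro c _
    have := Finset.card_filter_add_card_filter_not (s := (Finset.univ : Finset Ω)) (R c)
    have h4 : ((Finset.univ.filter (R c)).card : ℝ) + (Finset.univ.filter fun ω => ¬ R c ω).card
      = Fintype.card Ω := by exact_mod_cast this
    linarith [hR c]
  have h5 := Finset.sum_le_sum h3
  rw [h2] at h1
  simp only [Finset.sum_const, Finset.card_univ, nsmul_eq_mul] at h1 h5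
  nlinarith

variable [Fintype ι]

open Classical in
theorem exists_few_unsatisfied {R : ι → Ω → Prop} {p : ℝ} (hp : p ≤ 1)
    (hR : ∀ c, p * Fintype.card Ω ≤ (Finset.univ.filter (R c)).card) [Nonempty Ω] (m : ℕ) :
    ∃ ω : ℕ → Ω, ((Finset.univ.filter fun c => ∀ i < m, ¬ R c (ω i)).card : ℝ)
      ≤ (1 - p) ^ m * Fintype.card ι := by
  induction m with
  | zero => exact ⟨fun _ => Classical.arbitrary Ω, by simp⟩
  | succ m ih =>
    obtain ⟨ω, hω⟩ := ih
    obtain ⟨x, hx⟩ := exists_satisfying_many hR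
      (Finset.univ.filter fun c => ∀ i < m, ¬ R c (ω i))
    refine ⟨Function.update ω m x, ?_⟩
    have : (Finset.univ.filter fun c => ∀ i < m + 1, ¬ R c (Function.update ω m x i)) =
        (Finset.univ.filter fun c => ∀ i < m, ¬ R c (ω i)).filter fun c => ¬ R c x := by
      ext c
      simp only [Finset.mem_filter, Finset.mem_univ, true_and]
      constructor
      · intro h
        refine ⟨fun i hi => ?_, by simpa using h m (by omega)⟩
        simpa [Function.update_of_ne hi.ne] using h i (by omega)
      · rintro ⟨h1, h2⟩ i hi
        by_cases him : i = m
        · subst him; simpa using h2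
        · simpa [Function.update_of_ne him] using h1 i (by omega)
    rw [this, pow_succ']
    calc _ ≤ _ := hx
      _ ≤ (1 - p) * ((1 - p) ^ m * Fintype.card ι) := by
        have : 0 ≤ 1 - p := by linarith
        gcongr
      _ = _ := by ring

open Classical in
-- After `m` greedy choices fewer than one constraint is left, since `1 - p ≤ exp (-p)`.
theorem exists_satisfying_all {R : ι → Ω → Prop} {p : ℝ} (hp : p ≤ 1)
    (hR : ∀ c, p * Fintype.card Ω ≤ (Finset.univ.filter (R c)).card) [Nonempty Ω] {m : ℕ}
    (hm : (Fintype.card ι : ℝ) < Real.exp (p * m)) :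
    ∃ ω : ℕ → Ω, ∀ c, ∃ i < m, R c (ω i) := by
  obtain ⟨ω, hω⟩ := exists_few_unsatisfied hp hR m
  refine ⟨ω, ?_⟩
  have h1 : (1 - p) ^ m ≤ Real.exp (-(p * m)) := by
    calc (1 - p) ^ m ≤ Real.exp (-p) ^ m :=
          pow_le_pow_left₀ (by linarith) (Real.one_sub_le_exp_neg p) m
      _ = _ := by rw [← Real.exp_nat_mul]; ring_nf
  have h2 : ((Finset.univ.filter fun c => ∀ i < m, ¬ R c (ω i)).card : ℝ) < 1 := by
    calc _ ≤ _ := hω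
      _ ≤ Real.exp (-(p * m)) * Fintype.card ι := by gcongr
      _ < Real.exp (-(p * m)) * Real.exp (p * m) := by
        have := Real.exp_pos (-(p * m)); gcongr
      _ = 1 := by rw [← Real.exp_add]; simp
  have h3 : (Finset.univ.filter fun c => ∀ i < m, ¬ R c (ω i)).card = 0 := by
    have : (Finset.univ.filter fun c => ∀ i < m, ¬ R c (ω i)).card < 1 := by exact_mod_cast h2
    omega
  intro c
  by_contra! h
  have : c ∈ Finset.univ.filter fun c => ∀ i < m, ¬ R c (ω i) := by simpa using h
  rw [Finset.card_eq_zero.1 h3] at this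
  simp at this

end Greedy

theorem card_subtype_card_le_pow (E : Type*) [Fintype E] [DecidableEq E] (f : ℕ) :
    Fintype.card {F : Finset E // F.card ≤ f} ≤ (Fintype.card E + 1) ^ f := by
  have hsurj : ∀ F : {F : Finset E // F.card ≤ f}, ∃ a : Fin f → Option E,
      ∀ e, e ∈ F.1 ↔ ∃ i, a i = some e := by
    rintro ⟨F, hF⟩
    -- A listing of `F`, padded with `none` up to length `f`.
    refine ⟨fun i => F.toList[(i : ℕ)]?, fun e => ?_⟩
    rw [← Finset.mem_toList, List.mem_iff_getElem?]
    constructor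
    · rintro ⟨i, hi⟩
      obtain ⟨h, -⟩ := List.getElem?_eq_some_iff.1 hi
      exact ⟨⟨i, by simp at h; omega⟩, hi⟩
    · rintro ⟨i, hi⟩; exact ⟨i, hi⟩
  choose a ha using hsurj
  have hinj : Function.Injective a := by
    intro F G h
    apply Subtype.ext
    ext e
    rw [ha, ha, h]
  simpa using Fintype.card_le_of_injective a hinj

/-! ### The query program: correctness and step count -/

section Machine

/-- Straight-line code. -/
def Prog.straight : Instr → List Instr → Prog
  | i, [] => .instr i
  | i, j :: l => .seq (.instr i) (Prog.straight j l)

theorem Exec.straight {w : ℕ} {data query : List ℕ} (i : Instr) (l : List Instr) (σ : RamState) :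
    Exec w data query (Prog.straight i l) σ
      ((i :: l).foldl (fun s j => j.run w data query s) σ) (l.length + 1) := by
  induction l generalizing i σ with
  | nil => exact Exec.instr i σ
  | cons j l ih =>
    have := Exec.seq (Exec.instr (w := w) (data := data) (query := query) i σ) (ih j _)
    rwa [add_comm] at this

theorem length_queryWords {n : ℕ} (q : List (Fin n × Fin n)) :
    (queryWords q).length = 2 * q.length := by
  induction q with
  | nil => rfl
  | cons e q ih => simp [queryWords] at ih ⊢; omega

theorem getD_queryWords {n : ℕ} (p q : List (Fin n × Fin n)) (e : Fin n × Fin n) :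
    (queryWords (p ++ e :: q)).getD (2 * p.length) 0 = e.1 ∧
      (queryWords (p ++ e :: q)).getD (2 * p.length + 1) 0 = e.2 := by
  have h : queryWords (p ++ e :: q) = queryWords p ++ ((e.1 : ℕ) :: (e.2 : ℕ) :: queryWords q) := by
    simp [queryWords]
  rw [h, List.getD_append_right _ _ _ _ (by rw [length_queryWords]),
    List.getD_append_right _ _ _ _ (by rw [length_queryWords]; omega), length_queryWords]
  simp

/-- The sum of the entries, at the positions listed in `q`, of the matrix stored at `b`. -/
def entrySum {n : ℕ} (data : List ℕ) (q : List (Fin n × Fin n)) (b : ℕ) : ℕ :=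
  (q.map fun e => data.getD (b + (e.1 : ℕ) * n + (e.2 : ℕ)) 0).sum

/-- Adds to register `acc` the matrix entry, for the matrix stored at the address in register `b`,
whose position is read from the query. -/
def readEntry (b acc : ℕ) : Prog :=
  Prog.straight (.readQuery 10 8) [.add 8 8 1, .readQuery 11 8, .add 8 8 1, .mul 10 10 2,
    .add 10 10 11, .add 10 10 b, .readData 10 10, .add acc acc 10]

def sumEntries (b acc : ℕ) : Prog :=
  .whileLt 8 7 (readEntry b acc)

/-- The two register pairs are the two uses: summing codes (block address in `6`, total in `9`) and
counting surviving failing edges (graph address in `9`, total in `12`). The bounds by `2 ^ w`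
exclude wrap-around. -/
theorem exec_readEntry {w n : ℕ} {data : List ℕ} {b acc : ℕ}
    (hb : b = 6 ∧ acc = 9 ∨ b = 9 ∧ acc = 12) (p q : List (Fin n × Fin n)) (e : Fin n × Fin n)
    (σ : RamState) (h1 : σ.reg 1 = 1) (h2 : σ.reg 2 = n) (h8 : σ.reg 8 = 2 * p.length)
    (hq : 2 * (p ++ e :: q).length < 2 ^ w) (hn : n ^ 2 + σ.reg b < 2 ^ w)
    (hs : σ.reg acc + data.getD (σ.reg b + (e.1 : ℕ) * n + (e.2 : ℕ)) 0 < 2 ^ w) :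
    ∃ σ', Exec w data (queryWords (p ++ e :: q)) (readEntry b acc) σ σ' 9 ∧
      σ'.reg 8 = 2 * (p ++ [e]).length ∧
      σ'.reg acc = σ.reg acc + data.getD (σ.reg b + (e.1 : ℕ) * n + (e.2 : ℕ)) 0 ∧
      (∀ r, r ≠ 8 → r ≠ 10 → r ≠ 11 → r ≠ acc → σ'.reg r = σ.reg r) ∧ σ'.out = σ.out := by
  refine ⟨_, Exec.straight _ _ σ, ?_⟩
  obtain ⟨g1, g2⟩ := getD_queryWords p q e
  have hlen : 2 * p.length + 2 < 2 ^ w := by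
    simp only [List.length_append, List.length_cons] at hq; omega
  have m1 : (2 * p.length + 1) % 2 ^ w = 2 * p.length + 1 := Nat.mod_eq_of_lt (by omega)
  have m2 : (2 * p.length + 1 + 1) % 2 ^ w = 2 * p.length + 1 + 1 := Nat.mod_eq_of_lt (by omega)
  have hpos : (e.1 : ℕ) * n + (e.2 : ℕ) < n ^ 2 := by
    have ha := e.1.2
    have hc := e.2.2
    nlinarith
  have m3 : (e.1 : ℕ) * n % 2 ^ w = (e.1 : ℕ) * n := Nat.mod_eq_of_lt (by omega)
  have m4 : ((e.1 : ℕ) * n + (e.2 : ℕ)) % 2 ^ w = (e.1 : ℕ) * n + (e.2 : ℕ) :=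
    Nat.mod_eq_of_lt (by omega)
  have m5 : ((e.1 : ℕ) * n + (e.2 : ℕ) + σ.reg b) % 2 ^ w = σ.reg b + (e.1 : ℕ) * n + (e.2 : ℕ) := by
    rw [Nat.mod_eq_of_lt (by omega)]; ring
  have m6 := Nat.mod_eq_of_lt hs
  rcases hb with ⟨rfl, rfl⟩ | ⟨rfl, rfl⟩
  all_goals
    simp only [List.foldl, Instr.run, RamState.set, Function.update_apply, h1, h2, h8]
    norm_num only [if_true, if_false]
    simp only [m1, m2, g1, g2, m3, m4, m5, m6]
    refine ⟨by simp; omega, trivial, fun r r8 r10 r11 ra => ?_, trivial⟩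
    simp [r8, r10, r11, ra]

/-- Induction on the unread part `q` of the query, `p` being the part already read. Each edge costs
nine instructions and a test. -/
theorem exec_sumEntries {w n : ℕ} {data : List ℕ} {b acc : ℕ}
    (hb : b = 6 ∧ acc = 9 ∨ b = 9 ∧ acc = 12) (q p : List (Fin n × Fin n))
    (σ : RamState) (h1 : σ.reg 1 = 1) (h2 : σ.reg 2 = n) (h8 : σ.reg 8 = 2 * p.length)
    (h7 : σ.reg 7 = 2 * (p ++ q).length)
    (hq : 2 * (p ++ q).length < 2 ^ w) (hn : n ^ 2 + σ.reg b < 2 ^ w)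
    (hs : σ.reg acc + entrySum data q (σ.reg b) < 2 ^ w) :
    ∃ σ', Exec w data (queryWords (p ++ q)) (sumEntries b acc) σ σ' (10 * q.length + 1) ∧
      σ'.reg acc = σ.reg acc + entrySum data q (σ.reg b) ∧
      (∀ r, r ≠ 8 → r ≠ 10 → r ≠ 11 → r ≠ acc → σ'.reg r = σ.reg r) ∧ σ'.out = σ.out := by
  induction q generalizing p σ with
  | nil =>
    refine ⟨σ, Exec.whileFalse (by simp [h7, h8]), by simp [entrySum], fun _ _ _ _ _ => rfl, rfl⟩
  | cons e q ih =>
    have hsum : entrySum data (e :: q) (σ.reg b) =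
        data.getD (σ.reg b + (e.1 : ℕ) * n + (e.2 : ℕ)) 0 + entrySum data q (σ.reg b) := by
      simp [entrySum]
    rw [hsum] at hs ⊢
    obtain ⟨σ₁, x₁, r8, racc, rr, ro⟩ :=
      exec_readEntry (data := data) hb p q e σ h1 h2 h8 hq hn (by omega)
    have hassoc : p ++ e :: q = (p ++ [e]) ++ q := by simp
    have rb : σ₁.reg b = σ.reg b := rr b (by omega) (by omega) (by omega) (by omega)
    obtain ⟨σ₂, x₂, sacc, sr, so⟩ := ih (p ++ [e]) σ₁
      (by rw [rr 1 (by omega) (by omega) (by omega) (by omega), h1])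
      (by rw [rr 2 (by omega) (by omega) (by omega) (by omega), h2]) r8
      (by rw [rr 7 (by omega) (by omega) (by omega) (by omega), h7, hassoc])
      (by rwa [← hassoc]) (by rwa [rb]) (by rw [rb, racc]; omega)
    rw [← hassoc] at x₂
    refine ⟨σ₂, ?_, by rw [sacc, racc, rb, add_assoc], fun r a1 a2 a3 a4 => ?_, so.trans ro⟩
    · have := Exec.whileTrue (a := 8) (b := 7)
        (by rw [h7, h8]; simp) x₁ x₂
      convert this using 1
      · rfl
      · simp; ring
    · rw [sr r a1 a2 a3 a4, rr r a1 a2 a3 a4]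

/-- Treats the block at the address in register `6`: computes the address of the graph that the
query selects, and outputs it if that graph contains no failing edge. -/
def treatBlock : Prog :=
  .seq (Prog.straight (.const 8 0) [.const 9 0])
  (.seq (sumEntries 6 9)
  (.seq (Prog.straight (.mul 9 9 5) [.add 9 9 6, .add 9 9 5, .const 8 0, .const 12 0])
  (.seq (sumEntries 9 12)
  -- Register `1` holds `1`, so this tests for zero. The assignment to register `13` is a dummy that
  -- makes both branches equally long.
  (.seq (.ifLt 12 1 (.instr (.emit 9)) (.instr (.const 13 0)))
  (.instr (.add 6 6 3))))))

/-- The address of the graph that the query selects in the block at `b`. -/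
def selected {n : ℕ} (data : List ℕ) (q : List (Fin n × Fin n)) (b : ℕ) : ℕ :=
  entrySum data q b * n ^ 2 + b + n ^ 2

/-- The content of the registers during the main loop. -/
structure LoopState {n : ℕ} (D s : ℕ) (q : List (Fin n × Fin n)) (σ : RamState) : Prop where
  one : σ.reg 1 = 1
  verts : σ.reg 2 = n
  stride : σ.reg 3 = s
  stop_at : σ.reg 4 = D
  sq : σ.reg 5 = n ^ 2
  query : σ.reg 7 = 2 * q.length

/-- With `ℓ = q.length`, the steps of the six stages are `2`, `10 * ℓ + 1`, `5`, `10 * ℓ + 1`, `2`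
and `1`. -/
theorem exec_treatBlock {w n D s : ℕ} {data : List ℕ} {q : List (Fin n × Fin n)} {σ : RamState}
    (hσ : LoopState D s q σ) (hq : 2 * q.length < 2 ^ w)
    (ha : selected data q (σ.reg 6) + n ^ 2 < 2 ^ w)
    (hsum : entrySum data q (σ.reg 6) < 2 ^ w)
    (hz : entrySum data q (selected data q (σ.reg 6)) < 2 ^ w) (hb : σ.reg 6 + s < 2 ^ w) :
    ∃ σ', Exec w data (queryWords q) treatBlock σ σ' (20 * q.length + 12) ∧ LoopState D s q σ' ∧
      σ'.reg 6 = σ.reg 6 + s ∧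
      σ'.out = σ.out ++ if entrySum data q (selected data q (σ.reg 6)) = 0 then
        [selected data q (σ.reg 6)] else [] := by
  obtain ⟨h1, h2, h3, h4, h5, h7⟩ := hσ
  set b := σ.reg 6 with hbdef
  set a := selected data q b with hadef
  have haexp : entrySum data q b * n ^ 2 + b + n ^ 2 = a := rfl
  have hz0 : 0 % 2 ^ w = 0 := Nat.zero_mod _
  have x₁ := Exec.straight (w := w) (data := data) (query := queryWords q)
    (.const 8 0) [.const 9 0] σ
  set σ₁ := [Instr.const 8 0, Instr.const 9 0].foldl
    (fun s j => j.run w data (queryWords q) s) σ with hσ₁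
  have f₁ : ∀ r, r ≠ 8 → r ≠ 9 → σ₁.reg r = σ.reg r := by
    intro r a1 a2
    simp [hσ₁, Instr.run, RamState.set, a1, a2]
  have f8 : σ₁.reg 8 = 0 := by simp [hσ₁, Instr.run, RamState.set]
  have f9 : σ₁.reg 9 = 0 := by simp [hσ₁, Instr.run, RamState.set]
  have fo : σ₁.out = σ.out := rfl
  have f6 : σ₁.reg 6 = b := f₁ 6 (by omega) (by omega)
  obtain ⟨σ₂, x₂, g9, g, go⟩ := exec_sumEntries (w := w) (data := data) (b := 6) (acc := 9)
    (Or.inl ⟨rfl, rfl⟩) q [] σ₁ (by rw [f₁ 1 (by omega) (by omega), h1])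
    (by rw [f₁ 2 (by omega) (by omega), h2]) (by simpa using f8)
    (by rw [f₁ 7 (by omega) (by omega), h7]; rfl) hq (by rw [f6]; omega)
    (by rw [f6, f9]; omega)
  rw [f9, f6, zero_add] at g9
  have g' : ∀ r, r ≠ 8 → r ≠ 9 → r ≠ 10 → r ≠ 11 → σ₂.reg r = σ.reg r := fun r a1 a2 a3 a4 => by
    rw [g r a1 a3 a4 a2, f₁ r a1 a2]
  have x₃ := Exec.straight (w := w) (data := data) (query := queryWords q)
    (.mul 9 9 5) [.add 9 9 6, .add 9 9 5, .const 8 0, .const 12 0] σ₂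
  set σ₃ := [Instr.mul 9 9 5, .add 9 9 6, .add 9 9 5, .const 8 0, .const 12 0].foldl
    (fun s j => j.run w data (queryWords q) s) σ₂ with hσ₃
  have k : ∀ r, r ≠ 8 → r ≠ 9 → r ≠ 12 → σ₃.reg r = σ₂.reg r := by
    intro r a1 a2 a3
    simp [hσ₃, Instr.run, RamState.set, a1, a2, a3]
  have k8 : σ₃.reg 8 = 0 := by simp [hσ₃, Instr.run, RamState.set]
  have k12 : σ₃.reg 12 = 0 := by simp [hσ₃, Instr.run, RamState.set]
  have k9 : σ₃.reg 9 = a := by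
    have e5 : σ₂.reg 5 = n ^ 2 := by rw [g' 5 (by omega) (by omega) (by omega) (by omega), h5]
    have e6 : σ₂.reg 6 = b := g' 6 (by omega) (by omega) (by omega) (by omega)
    have m1 : entrySum data q b * n ^ 2 % 2 ^ w = entrySum data q b * n ^ 2 :=
      Nat.mod_eq_of_lt (by omega)
    have m2 : (entrySum data q b * n ^ 2 + b) % 2 ^ w = entrySum data q b * n ^ 2 + b :=
      Nat.mod_eq_of_lt (by omega)
    have m3 : a % 2 ^ w = a := Nat.mod_eq_of_lt (by omega)
    simp only [hσ₃, List.foldl, Instr.run, RamState.set, Function.update_apply]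
    norm_num only [if_true, if_false]
    simp only [g9, e5, e6, m1, m2, haexp, m3]
  have ko : σ₃.out = σ₂.out := rfl
  have k' : ∀ r, r ≠ 8 → r ≠ 9 → r ≠ 10 → r ≠ 11 → r ≠ 12 → σ₃.reg r = σ.reg r :=
    fun r a1 a2 a3 a4 a5 => by rw [k r a1 a2 a5, g' r a1 a2 a3 a4]
  obtain ⟨σ₄, x₄, l12, l, lo⟩ := exec_sumEntries (w := w) (data := data) (b := 9) (acc := 12)
    (Or.inr ⟨rfl, rfl⟩) q [] σ₃
    (by rw [k' 1 (by omega) (by omega) (by omega) (by omega) (by omega), h1])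
    (by rw [k' 2 (by omega) (by omega) (by omega) (by omega) (by omega), h2])
    (by simpa using k8)
    (by rw [k' 7 (by omega) (by omega) (by omega) (by omega) (by omega), h7]; rfl) hq
    (by rw [k9]; omega) (by rw [k9, k12]; omega)
  rw [k12, k9, zero_add] at l12
  have l9 : σ₄.reg 9 = a := by rw [l 9 (by omega) (by omega) (by omega) (by omega), k9]
  have l' : ∀ r, r ≠ 8 → r ≠ 9 → r ≠ 10 → r ≠ 11 → r ≠ 12 → σ₄.reg r = σ.reg r :=
    fun r a1 a2 a3 a4 a5 => by rw [l r a1 a3 a4 a5, k' r a1 a2 a3 a4 a5]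
  have l1 : σ₄.reg 1 = 1 := by
    rw [l' 1 (by omega) (by omega) (by omega) (by omega) (by omega), h1]
  have hout : σ₄.out = σ.out := by rw [lo, ko, go, fo]
  obtain ⟨σ₅, x₅, u, uo⟩ : ∃ σ₅, Exec w data (queryWords q)
      (.ifLt 12 1 (.instr (.emit 9)) (.instr (.const 13 0))) σ₄ σ₅ 2 ∧
      (∀ r, r ≠ 13 → σ₅.reg r = σ₄.reg r) ∧
      σ₅.out = σ.out ++ if entrySum data q a = 0 then [a] else [] := by
    by_cases h0 : entrySum data q a = 0
    · refine ⟨_, Exec.ifTrue (by rw [l12, l1]; omega) (Exec.instr _ _), fun r _ => rfl, ?_⟩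
      simp [Instr.run, l9, hout, h0]
    · refine ⟨_, Exec.ifFalse (by rw [l12, l1]; omega) (Exec.instr _ _), fun r hr => ?_, ?_⟩
      · simp [Instr.run, RamState.set, hr]
      · simp [Instr.run, RamState.set, hout, h0]
  have u' : ∀ r, r ≠ 8 → r ≠ 9 → r ≠ 10 → r ≠ 11 → r ≠ 12 → r ≠ 13 → σ₅.reg r = σ.reg r :=
    fun r a1 a2 a3 a4 a5 a6 => by rw [u r a6, l' r a1 a2 a3 a4 a5]
  have x₆ := Exec.instr (w := w) (data := data) (query := queryWords q) (.add 6 6 3) σ₅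
  set σ₆ := Instr.run w data (queryWords q) σ₅ (.add 6 6 3) with hσ₆
  have v : ∀ r, r ≠ 6 → σ₆.reg r = σ₅.reg r := by
    intro r hr
    simp [hσ₆, Instr.run, RamState.set, hr]
  have v' : ∀ r, r ≠ 6 → r ≠ 8 → r ≠ 9 → r ≠ 10 → r ≠ 11 → r ≠ 12 → r ≠ 13 →
      σ₆.reg r = σ.reg r :=
    fun r a0 a1 a2 a3 a4 a5 a6 => by rw [v r a0, u' r a1 a2 a3 a4 a5 a6]
  refine ⟨σ₆, ?_, ⟨?_, ?_, ?_, ?_, ?_, ?_⟩, ?_, uo⟩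
  · have := x₁.seq (Exec.seq x₂ (x₃.seq (Exec.seq x₄ (x₅.seq x₆))))
    convert this using 1
    · rfl
    · simp; ring
  · rw [v' 1 (by omega) (by omega) (by omega) (by omega) (by omega) (by omega) (by omega), h1]
  · rw [v' 2 (by omega) (by omega) (by omega) (by omega) (by omega) (by omega) (by omega), h2]
  · rw [v' 3 (by omega) (by omega) (by omega) (by omega) (by omega) (by omega) (by omega), h3]
  · rw [v' 4 (by omega) (by omega) (by omega) (by omega) (by omega) (by omega) (by omega), h4]
  · rw [v' 5 (by omega) (by omega) (by omega) (by omega) (by omega) (by omega) (by omega), h5]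
  · rw [v' 7 (by omega) (by omega) (by omega) (by omega) (by omega) (by omega) (by omega), h7]
  · have e3 : σ₅.reg 3 = s := by
      rw [u' 3 (by omega) (by omega) (by omega) (by omega) (by omega) (by omega), h3]
    have e6 : σ₅.reg 6 = b :=
      u' 6 (by omega) (by omega) (by omega) (by omega) (by omega) (by omega)
    simp [hσ₆, Instr.run, RamState.set, e3, e6, Nat.mod_eq_of_lt hb]

/-- Induction on the number `r` of blocks still to be treated, from block `i` on. The three header
words put block `i` at address `3 + i * s`. -/
theorem exec_treatBlocks {w n s m : ℕ} {data : List ℕ} {q : List (Fin n × Fin n)}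
    (hs : 0 < s) (hq : 2 * q.length < 2 ^ w) (hD : 3 + m * s < 2 ^ w)
    (ha : ∀ i < m, selected data q (3 + i * s) + n ^ 2 < 2 ^ w)
    (hsum : ∀ i < m, entrySum data q (3 + i * s) < 2 ^ w)
    (hz : ∀ i < m, entrySum data q (selected data q (3 + i * s)) < 2 ^ w)
    (r i : ℕ) (hr : i + r = m) (σ : RamState) (hσ : LoopState (3 + m * s) s q σ)
    (h6 : σ.reg 6 = 3 + i * s) :
    ∃ σ', Exec w data (queryWords q) (.whileLt 6 4 treatBlock) σ σ'
        (r * (20 * q.length + 13) + 1) ∧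
      σ'.out = σ.out ++ ((List.range' i r).filter fun j =>
        entrySum data q (selected data q (3 + j * s)) = 0).map
          fun j => selected data q (3 + j * s) := by
  induction r generalizing i σ with
  | zero =>
    have : i = m := by omega
    refine ⟨σ, ?_, by simp⟩
    simpa using Exec.whileFalse (by rw [h6, hσ.stop_at, this]; omega)
  | succ r ih =>
    have hi : i < m := by omega
    have his : (i + 1) * s ≤ m * s := Nat.mul_le_mul_right _ hi
    have hexp : (i + 1) * s = i * s + s := by ring
    obtain ⟨σ₁, x₁, hσ₁, g6, go⟩ := exec_treatBlock (w := w) (data := data) hσ hq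
      (by rw [h6]; exact ha i hi) (by rw [h6]; exact hsum i hi)
      (by rw [h6]; exact hz i hi) (by rw [h6]; omega)
    obtain ⟨σ₂, x₂, ho⟩ := ih (i + 1) (by omega) σ₁ hσ₁ (by rw [g6, h6, hexp]; ring)
    refine ⟨σ₂, ?_, ?_⟩
    · have := Exec.whileTrue (a := 6) (b := 4) (by rw [h6, hσ.stop_at]; omega) x₁ x₂
      convert this using 1
      ring
    · rw [ho, go, h6, List.range'_succ, List.append_assoc, List.filter_cons]
      congr 1
      split_ifs <;> simp_all

/-- The query program. -/
def queryProg : Prog :=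
  -- Register `20` is never written and serves as the address `0`. The three header words give the
  -- vertex number, the block length and the end address.
  .seq (Prog.straight (.const 1 1) [.readData 2 20, .readData 3 1, .add 4 1 1, .readData 4 4,
    .mul 5 2 2, .const 6 3, .add 7 0 0]) (.whileLt 6 4 treatBlock)

theorem exec_queryProg {w n s m : ℕ} {data : List ℕ} {q : List (Fin n × Fin n)}
    (hd0 : data.getD 0 0 = n) (hd1 : data.getD 1 0 = s) (hd2 : data.getD 2 0 = 3 + m * s)
    (hs : 0 < s) (hq : 2 * q.length < 2 ^ w) (hn : n ^ 2 < 2 ^ w) (hD : 3 + m * s < 2 ^ w)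
    (ha : ∀ i < m, selected data q (3 + i * s) + n ^ 2 < 2 ^ w)
    (hsum : ∀ i < m, entrySum data q (3 + i * s) < 2 ^ w)
    (hz : ∀ i < m, entrySum data q (selected data q (3 + i * s)) < 2 ^ w) :
    ∃ σ', Exec w data (queryWords q) queryProg (startState q.length) σ'
        (m * (20 * q.length + 13) + 9) ∧
      σ'.out = ((List.range m).filter fun j =>
        entrySum data q (selected data q (3 + j * s)) = 0).map
          fun j => selected data q (3 + j * s) := by
  have x₁ := Exec.straight (w := w) (data := data) (query := queryWords q)
    (.const 1 1) [.readData 2 20, .readData 3 1, .add 4 1 1, .readData 4 4,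
    .mul 5 2 2, .const 6 3, .add 7 0 0] (startState q.length)
  set σ₁ := [Instr.const 1 1, .readData 2 20, .readData 3 1, .add 4 1 1, .readData 4 4,
    .mul 5 2 2, .const 6 3, .add 7 0 0].foldl
    (fun s j => j.run w data (queryWords q) s) (startState q.length) with hσ₁
  have m1 : 1 % 2 ^ w = 1 := Nat.mod_eq_of_lt (by omega)
  have m2 : 2 % 2 ^ w = 2 := Nat.mod_eq_of_lt (by omega)
  have m3 : 3 % 2 ^ w = 3 := Nat.mod_eq_of_lt (by omega)
  have m4 : n * n % 2 ^ w = n ^ 2 := by rw [← pow_two, Nat.mod_eq_of_lt hn]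
  have m5 : (q.length + q.length) % 2 ^ w = 2 * q.length := by
    rw [Nat.mod_eq_of_lt (by omega)]; ring
  have hreg : σ₁.reg 1 = 1 ∧ σ₁.reg 2 = n ∧ σ₁.reg 3 = s ∧ σ₁.reg 4 = 3 + m * s ∧
      σ₁.reg 5 = n ^ 2 ∧ σ₁.reg 7 = 2 * q.length ∧ σ₁.reg 6 = 3 := by
    simp only [hσ₁, List.foldl, Instr.run, RamState.set, Function.update_apply, startState]
    norm_num only [if_true, if_false]
    simp only [m1, one_add_one_eq_two, m2, m3, m5, hd0, hd1, hd2, m4, and_self]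
  obtain ⟨h1, h2, h3, h4, h5, h7, h6⟩ := hreg
  obtain ⟨σ₂, x₂, ho⟩ := exec_treatBlocks hs hq hD ha hsum hz m 0 (by omega) σ₁
    ⟨h1, h2, h3, h4, h5, h7⟩ (by rw [h6]; ring)
  refine ⟨σ₂, ?_, ?_⟩
  · have := x₁.seq x₂
    convert this using 1
    · rfl
    · simp; ring
  · have : σ₁.out = [] := rfl
    rw [ho, this, List.range_eq_range']
    rfl

end Machine

/-! ### Separating functions for shortest paths -/

section Covering

theorem Edge.exists_link {k : EdgeKind} {n : ℕ} (e : Edge k n) : ∃ u v, Edge.link u v = e := by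
  cases k with
  | directed => exact ⟨e.1, e.2, rfl⟩
  | undirected => induction e using Sym2.ind with | _ u v => exact ⟨u, v, rfl⟩

theorem exists_separating_family {E V : Type*} [Fintype E] [DecidableEq E] [Fintype V]
    {f L m : ℕ} (hf : 0 < f) (hL : 0 < L) (P : Finset E → V → V → Finset E)
    (hP : ∀ F s t, (P F s t).card ≤ L) (hd : ∀ F s t, Disjoint F (P F s t))
    (hm : ((Fintype.card E + 1) ^ f * Fintype.card V ^ 2 : ℝ) <
      Real.exp (Real.exp (-f) / 2 * m)) :
    ∃ φ : ℕ → E → Fin f × Fin (2 * L), ∀ F : Finset E, F.card ≤ f → ∀ s t,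
      ∃ i < m, Separates F (P F s t) (φ i) := by
  classical
  have : Nonempty (Fin f × Fin (2 * L)) := ⟨⟨0, hf⟩, ⟨0, by omega⟩⟩
  have hcard : (Fintype.card ({F : Finset E // F.card ≤ f} × V × V) : ℝ) ≤
      (Fintype.card E + 1) ^ f * Fintype.card V ^ 2 := by
    have := card_subtype_card_le_pow E f
    rw [Fintype.card_prod, Fintype.card_prod, pow_two]
    exact_mod_cast Nat.mul_le_mul_right _ this
  obtain ⟨φ, hφ⟩ := exists_satisfying_all (ι := {F : Finset E // F.card ≤ f} × V × V)
    (R := fun c φ => Separates c.1.1 (P c.1.1 c.2.1 c.2.2) φ) (p := Real.exp (-f) / 2) (m := m)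
    (by have := Real.exp_le_one_iff.2 (neg_nonpos.2 (Nat.cast_nonneg (α := ℝ) f)); linarith)
    (fun c => card_separates_ge hL c.1.2 (hP _ _ _) (hd _ _ _)) (hcard.trans_lt hm)
  exact ⟨φ, fun F hF s t => hφ (⟨F, hF⟩, s, t)⟩

theorem length_walkEdges {k : EdgeKind} {n : ℕ} (s : Fin n) (p : List (Fin n)) :
    (walkEdges s p : List (Edge k n)).length = p.length := by
  induction p generalizing s with
  | nil => rfl
  | cons v p ih => simp [walkEdges, ih]

theorem exists_separating_paths {k : EdgeKind} {n : ℕ} (G : WGraph k n) {f L m : ℕ} (hf : 0 < f)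
    (hL : 0 < L)
    (hm : (((n : ℝ) ^ 2 + 1) ^ f * (n : ℝ) ^ 2) < Real.exp (Real.exp (-f) / 2 * m)) :
    ∃ φ : ℕ → Edge k n → Fin f × Fin (2 * L), ∀ F : Finset (Edge k n), F.card ≤ f → ∀ s t,
      (∃ p, G.IsShortestPath (G.edges \ (F : Set (Edge k n))) s t p ∧ p.length ≤ L) →
      ∃ i < m, ∃ p, G.IsShortestPath (G.edges \ (F : Set (Edge k n))) s t p ∧ p.length ≤ L ∧
        (∀ e ∈ F, Removed (φ i) (edgeCode (φ i) F) e) ∧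
        ∀ e ∈ walkEdges s p, ¬ Removed (φ i) (edgeCode (φ i) F) e := by
  classical
  have hsurj : Function.Surjective fun p : Fin n × Fin n => (Edge.link p.1 p.2 : Edge k n) :=
    fun e => by
      obtain ⟨u, v, h⟩ := e.exists_link
      exact ⟨(u, v), h⟩
  let _ : Fintype (Edge k n) := Fintype.ofSurjective _ hsurj
  have hE : Fintype.card (Edge k n) ≤ n ^ 2 := by
    simpa [pow_two] using Fintype.card_le_of_surjective _ hsurj
  have hE' : (Fintype.card (Edge k n) : ℝ) ≤ (n : ℝ) ^ 2 := by exact_mod_cast hE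
  -- One short shortest path is fixed per triple. Where none exists, the empty set keeps the size
  -- and disjointness conditions true.
  let P : Finset (Edge k n) → Fin n → Fin n → Finset (Edge k n) := fun F s t =>
    if h : ∃ p, G.IsShortestPath (G.edges \ (F : Set (Edge k n))) s t p ∧ p.length ≤ L then
      (walkEdges s h.choose).toFinset else ∅
  obtain ⟨φ, hφ⟩ := exists_separating_family (m := m) hf hL P
    (fun F s t => by
      simp only [P]
      split_ifs with h
      · exact (List.toFinset_card_le _).trans (by rw [length_walkEdges]; exact h.choose_spec.2)
      · simp)
    (fun F s t => by
      simp only [P]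
      split_ifs with h
      · rw [Finset.disjoint_right]
        intro e he
        exact (h.choose_spec.1.1.edges_mem e (by simpa using he)).2
      · simp)
    (by
      refine lt_of_le_of_lt ?_ hm
      rw [Fintype.card_fin]
      gcongr)
  refine ⟨φ, fun F hF s t h => ?_⟩
  obtain ⟨i, hi, h1, h2⟩ := hφ F hF s t
  refine ⟨i, hi, h.choose, h.choose_spec.1, h.choose_spec.2, h1, fun e he => h2 e ?_⟩
  simp only [P, dif_pos h]
  simpa using he

/-! ### The covering and its data structure -/

variable {k : EdgeKind} {n f L m : ℕ}

/-- The number of graphs that belong to one function. -/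
def graphCount (f L : ℕ) : ℕ := f * (2 * L) ^ f + 1

/-- The graph number `x` of the function `φ`. -/
def codeGraph (G : WGraph k n) (φ : Edge k n → Fin f × Fin (2 * L)) (x : ℕ) : Set (Edge k n) :=
  {e | e ∈ G.edges ∧ ¬ Removed φ x e}

theorem edgeCode_lt_graphCount (φ : Edge k n → Fin f × Fin (2 * L)) {F : Finset (Edge k n)}
    (hF : F.card ≤ f) : edgeCode φ F < graphCount f L :=
  Nat.lt_succ_of_le (edgeCode_le φ hF)

open Classical in
/-- The covering consisting of all graphs of the first `m` functions. -/
noncomputable def codeRPC (G : WGraph k n) (φ : ℕ → Edge k n → Fin f × Fin (2 * L))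
    (hφ : ∀ F : Finset (Edge k n), F.card ≤ f → ∀ s t,
      (∃ p, G.IsShortestPath (G.edges \ (F : Set (Edge k n))) s t p ∧ p.length ≤ L) →
      ∃ i < m, ∃ p, G.IsShortestPath (G.edges \ (F : Set (Edge k n))) s t p ∧ p.length ≤ L ∧
        (∀ e ∈ F, Removed (φ i) (edgeCode (φ i) F) e) ∧
        ∀ e ∈ walkEdges s p, ¬ Removed (φ i) (edgeCode (φ i) F) e) : RPC G L f where
  size := m * graphCount f L
  graph j := codeGraph G (φ (j / graphCount f L)) (j % graphCount f L)
  graph_subset _ _ h := h.1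
  sub F := Finset.univ.filter fun j : Fin (m * graphCount f L) =>
    (j : ℕ) % graphCount f L = edgeCode (φ (j / graphCount f L)) F ∧
      ∀ e ∈ F, e ∉ codeGraph G (φ (j / graphCount f L)) (j % graphCount f L)
  avoids F _ _ i hi := (Finset.mem_filter.1 hi).2.2
  covers F _ hF s t h := by
    obtain ⟨i, hi, p, hp, hpL, h1, h2⟩ := hφ F hF s t h
    have hx := edgeCode_lt_graphCount (φ i) hF
    -- The covering graph is the one that function `i` assigns to the code of `F`.
    have hlt : i * graphCount f L + edgeCode (φ i) F < m * graphCount f L := by nlinarith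
    have hdiv : (i * graphCount f L + edgeCode (φ i) F) / graphCount f L = i := by
      rw [mul_comm, Nat.mul_add_div (by omega), Nat.div_eq_of_lt hx, add_zero]
    have hmod : (i * graphCount f L + edgeCode (φ i) F) % graphCount f L = edgeCode (φ i) F := by
      rw [mul_comm, Nat.mul_add_mod, Nat.mod_eq_of_lt hx]
    refine ⟨⟨_, hlt⟩, ?_, p, hp, hpL, ?_⟩
    · simp only [Finset.mem_filter, Finset.mem_univ, true_and, hdiv, hmod]
      exact fun e he hg => hg.2 (h1 e he)
    · simp only [hdiv, hmod]
      exact ⟨hp.1.nodup, hp.1.last_eq, fun e he => ⟨(hp.1.edges_mem e he).1, h2 e he⟩⟩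

/-- Three words followed by `K` matrices. -/
theorem exists_tables (hn : 0 < n) (K a b c : ℕ) (T : ℕ → Fin n → Fin n → ℕ) :
    ∃ data : List ℕ, data.length = 3 + K * n ^ 2 ∧ data.getD 0 0 = a ∧ data.getD 1 0 = b ∧
      data.getD 2 0 = c ∧
      (∀ j < K, ∀ u v : Fin n, data.getD (3 + j * n ^ 2 + (u : ℕ) * n + (v : ℕ)) 0 = T j u v) ∧
      ∀ x ∈ data, x = a ∨ x = b ∨ x = c ∨ ∃ j < K, ∃ u v, x = T j u v := by
  have hn2 : 0 < n ^ 2 := by positivity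
  refine ⟨a :: b :: c :: (List.range (K * n ^ 2)).map fun i => T (i / n ^ 2)
    ⟨i % n ^ 2 / n, Nat.div_lt_of_lt_mul (by rw [← pow_two]; exact Nat.mod_lt _ hn2)⟩
    ⟨i % n, Nat.mod_lt _ hn⟩, by simp; omega, rfl, rfl, rfl, ?_, ?_⟩
  · intro j hj u v
    have hu := u.2
    have hv := v.2
    have huv : (u : ℕ) * n + v < n ^ 2 := by nlinarith
    have hlt : j * n ^ 2 + (u * n + v) < K * n ^ 2 := by nlinarith
    have e0 : 3 + j * n ^ 2 + (u : ℕ) * n + (v : ℕ) = j * n ^ 2 + (u * n + v) + 3 := by ring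
    have e1 : (j * n ^ 2 + ((u : ℕ) * n + v)) / n ^ 2 = j := by
      rw [mul_comm j, Nat.mul_add_div hn2, Nat.div_eq_of_lt huv, add_zero]
    have e2 : (j * n ^ 2 + ((u : ℕ) * n + v)) % n ^ 2 / n = u := by
      rw [mul_comm j, Nat.mul_add_mod, Nat.mod_eq_of_lt huv, mul_comm, Nat.mul_add_div hn,
        Nat.div_eq_of_lt hv, add_zero]
    have e3 : (j * n ^ 2 + ((u : ℕ) * n + v)) % n = v := by
      have : j * n ^ 2 + ((u : ℕ) * n + v) = n * (j * n + u) + v := by ring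
      rw [this, Nat.mul_add_mod, Nat.mod_eq_of_lt hv]
    rw [e0]
    simp only [List.getD_cons_succ]
    rw [List.getD_eq_getElem _ _ (by simpa using hlt)]
    simp only [List.getElem_map, List.getElem_range, e1, e2, e3]
  · intro x hx
    simp only [List.mem_cons, List.mem_map, List.mem_range] at hx
    rcases hx with h | h | h | ⟨i, hi, rfl⟩
    · exact Or.inl h
    · exact Or.inr (Or.inl h)
    · exact Or.inr (Or.inr (Or.inl h))
    · exact Or.inr (Or.inr (Or.inr ⟨_, Nat.div_lt_of_lt_mul (by rwa [mul_comm]), _, _, rfl⟩))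

open Classical in
/-- The `j`-th stored matrix: every function contributes its table of codes and then the adjacency
matrices of its graphs. -/
noncomputable def storedMatrix (G : WGraph k n) (φ : ℕ → Edge k n → Fin f × Fin (2 * L))
    (j : ℕ) (u v : Fin n) : ℕ :=
  if j % (graphCount f L + 1) = 0 then
    edgeCode (φ (j / (graphCount f L + 1))) {Edge.link u v}
  else if Edge.link u v ∈ codeGraph G (φ (j / (graphCount f L + 1)))
    (j % (graphCount f L + 1) - 1) then 1 else 0

theorem hasCovering_of_separating (G : WGraph k n) (hn : 2 ≤ n) (hf : 0 < f) (hm : 0 < m)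
    (φ : ℕ → Edge k n → Fin f × Fin (2 * L))
    (hφ : ∀ F : Finset (Edge k n), F.card ≤ f → ∀ s t,
      (∃ p, G.IsShortestPath (G.edges \ (F : Set (Edge k n))) s t p ∧ p.length ≤ L) →
      ∃ i < m, ∃ p, G.IsShortestPath (G.edges \ (F : Set (Edge k n))) s t p ∧ p.length ≤ L ∧
        (∀ e ∈ F, Removed (φ i) (edgeCode (φ i) F) e) ∧
        ∀ e ∈ walkEdges s p, ¬ Removed (φ i) (edgeCode (φ i) F) e) :
    HasCovering G L f queryProg 2 (m * (graphCount f L + 2) : ℕ) (m * (20 * f + 13) + 9 : ℕ)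
      (m : ℕ) := by
  classical
  set M := graphCount f L with hM
  have hMpos : 0 < M := Nat.succ_pos _
  set s := (M + 1) * n ^ 2 with hs
  set D := 3 + m * s with hD
  have hn2 : 4 ≤ n ^ 2 := by nlinarith
  have hD' : 3 + m * (M + 1) * n ^ 2 = D := by rw [hD, hs]; ring
  -- Since `D < 2 ^ w`, this leaves room for codes, query addresses and entry counts.
  have hDM : 4 * M + n ^ 2 < D := by
    have h1 : s ≤ m * s := Nat.le_mul_of_pos_left _ hm
    have h2 : M * 4 ≤ M * n ^ 2 := Nat.mul_le_mul_left _ hn2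
    have h3 : s = M * n ^ 2 + n ^ 2 := by rw [hs]; ring
    omega
  have hsD : s < D := by
    have h1 : s ≤ m * s := Nat.le_mul_of_pos_left _ hm
    omega
  obtain ⟨data, hlen, hd0, hd1, hd2, htab, hmem⟩ :=
    exists_tables (n := n) (by omega) (m * (M + 1)) n s D (storedMatrix G φ)
  rw [hD'] at hlen
  -- `D` is the length of the data, and `2 ^ w ≤ 2 * D` gives the exponent `2` in the word length
  -- condition.
  set w := Nat.log 2 D + 1 with hw
  have hwD : D < 2 ^ w := Nat.lt_pow_succ_log_self (by norm_num) D
  have hwD2 : 2 ^ w ≤ 2 * D := by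
    rw [hw, pow_succ, mul_comm]
    exact Nat.mul_le_mul_left _ (Nat.pow_log_le_self 2 (by omega))
  have hfM : f < M := by
    have hL : 0 < L := by
      by_contra hL
      have := (φ 0 (Edge.link ⟨0, by omega⟩ ⟨0, by omega⟩)).2.2
      omega
    have : 1 ≤ (2 * L) ^ f := Nat.one_le_pow _ _ (by omega)
    have : f * 1 ≤ f * (2 * L) ^ f := Nat.mul_le_mul_left _ this
    simp only [hM, graphCount]; omega
  have hcode : ∀ i < m, ∀ u v : Fin n, data.getD (3 + i * s + (u : ℕ) * n + (v : ℕ)) 0 =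
      edgeCode (φ i) {Edge.link u v} := by
    intro i hi u v
    have h := htab (i * (M + 1)) (Nat.mul_lt_mul_of_pos_right hi (by omega)) u v
    rw [show i * s = i * (M + 1) * n ^ 2 by rw [hs]; ring, h, storedMatrix, ← hM,
      if_pos (Nat.mul_mod_left _ _), Nat.mul_div_cancel _ (by omega)]
  have hentry : ∀ i < m, ∀ x < M, ∀ u v : Fin n,
      data.getD (3 + i * s + (x + 1) * n ^ 2 + (u : ℕ) * n + (v : ℕ)) 0 =
        if Edge.link u v ∈ codeGraph G (φ i) x then 1 else 0 := by
    intro i hi x hx u v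
    have hlt : (M + 1) * i + (x + 1) < m * (M + 1) := by nlinarith
    have h := htab ((M + 1) * i + (x + 1)) hlt u v
    have hmod : ((M + 1) * i + (x + 1)) % (M + 1) = x + 1 := by
      rw [Nat.mul_add_mod, Nat.mod_eq_of_lt (by omega)]
    have hdiv : ((M + 1) * i + (x + 1)) / (M + 1) = i := by
      rw [Nat.mul_add_div (by omega), Nat.div_eq_of_lt (by omega), add_zero]
    rw [show 3 + i * s + (x + 1) * n ^ 2 = 3 + ((M + 1) * i + (x + 1)) * n ^ 2 by rw [hs]; ring,
      h, storedMatrix, ← hM, hmod, hdiv, if_neg (by omega), Nat.add_sub_cancel]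
  have hbound : ∀ i < m, ∀ x < M, 3 + i * s + (x + 1) * n ^ 2 + n ^ 2 ≤ D := by
    intro i hi x hx
    have h1 : (i + 1) * s ≤ m * s := Nat.mul_le_mul_right _ hi
    have h2 : (x + 1 + 1) * n ^ 2 ≤ s := Nat.mul_le_mul_right _ (by omega)
    have h3 : (i + 1) * s = i * s + s := by ring
    have h4 : (x + 1 + 1) * n ^ 2 = (x + 1) * n ^ 2 + n ^ 2 := by ring
    omega
  let loc : Fin (codeRPC (m := m) G φ hφ).size → ℕ := fun j =>
    3 + ((j : ℕ) / M) * s + ((j : ℕ) % M + 1) * n ^ 2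
  have hdivlt : ∀ j : Fin (codeRPC (m := m) G φ hφ).size, (j : ℕ) / M < m := fun j =>
    Nat.div_lt_of_lt_mul (by rw [mul_comm]; exact j.2)
  refine ⟨codeRPC (m := m) G φ hφ, w, data, loc, ?_, ?_, ?_, ?_, by omega, ?_, ?_, ?_⟩
  · have : (codeRPC (m := m) G φ hφ).size = m * M := rfl
    rw [this]
    exact_mod_cast Nat.mul_le_mul_left _ (by omega)
  · intro F _ hF
    -- A member is determined by its function, because its number within the block must be the code
    -- of `F`.
    have : ((codeRPC (m := m) G φ hφ).sub F).card ≤ (Finset.range m).card := by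
      refine Finset.card_le_card_of_injOn (fun j => (j : ℕ) / M) ?_ ?_
      · intro j _
        simpa using hdivlt j
      · intro i hi j hj hij
        have hi' := (Finset.mem_filter.1 (Finset.mem_coe.1 hi)).2.1
        have hj' := (Finset.mem_filter.1 (Finset.mem_coe.1 hj)).2.1
        simp only at hij
        change (i : ℕ) % M = edgeCode (φ (i / M)) F at hi'
        change (j : ℕ) % M = edgeCode (φ (j / M)) F at hj'
        apply Fin.ext
        rw [← Nat.div_add_mod (i : ℕ) M, ← Nat.div_add_mod (j : ℕ) M, hi', hj', hij]
    exact_mod_cast this.trans_eq (Finset.card_range m)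
  · rw [hlen, ← hD']
    -- The header fits into one extra matrix per function.
    have : 3 + m * (M + 1) * n ^ 2 ≤ m * (M + 2) * n ^ 2 := by nlinarith
    exact_mod_cast this
  · rw [hlen]
    nlinarith
  · intro x hx
    rcases hmem x hx with rfl | rfl | rfl | ⟨j, _, u, v, rfl⟩
    · nlinarith
    · omega
    · omega
    · unfold storedMatrix
      split_ifs
      · have := edgeCode_lt_graphCount (φ (j / (graphCount f L + 1)))
          (F := {Edge.link u v}) (by rw [Finset.card_singleton]; exact hf)
        omega
      · omega
      · omega
  · intro j
    refine ⟨(hbound _ (hdivlt j) _ (Nat.mod_lt _ hMpos)).trans hlen.ge, fun u v => ?_⟩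
    have := hentry _ (hdivlt j) _ (Nat.mod_lt (j : ℕ) hMpos) u v
    simp only [loc]
    rw [this]
    change _ ∈ codeGraph G (φ ((j : ℕ) / M)) ((j : ℕ) % M) ↔ _
    split_ifs with h <;> simp [h]
  · intro F _ hF q hq hqF
    have hqF' : (q.map fun e => (Edge.link e.1 e.2 : Edge k n)).toFinset = F := by
      ext e; rw [List.mem_toFinset, hqF]
    have hqlen : q.length ≤ f := by
      rw [← hqF', List.toFinset_card_of_nodup hq, List.length_map] at hF
      exact hF
    have hlt : ∀ i, edgeCode (φ i) F < M := fun i => edgeCode_lt_graphCount (φ i) hF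
    -- Additivity of the code; distinctness of the queried edges turns the list sum into a sum over
    -- `F`.
    have hsum : ∀ i < m, entrySum data q (3 + i * s) = edgeCode (φ i) F := by
      intro i hi
      rw [entrySum, List.map_congr_left fun e _ => hcode i hi e.1 e.2, ← hqF', edgeCode,
        List.sum_toFinset _ hq, List.map_map]
      simp [edgeCode, Function.comp_def]
    have hsel : ∀ i < m, selected data q (3 + i * s) =
        3 + i * s + (edgeCode (φ i) F + 1) * n ^ 2 := by
      intro i hi
      rw [selected, hsum i hi]; ring
    have hval : ∀ i < m, entrySum data q (selected data q (3 + i * s)) =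
        (q.map fun e => if (Edge.link e.1 e.2 : Edge k n) ∈
          codeGraph G (φ i) (edgeCode (φ i) F) then 1 else 0).sum := by
      intro i hi
      rw [hsel i hi, entrySum, List.map_congr_left fun e _ => hentry i hi _ (hlt i) e.1 e.2]
    have hzero : ∀ i < m, entrySum data q (selected data q (3 + i * s)) = 0 ↔
        ∀ e ∈ F, e ∉ codeGraph G (φ i) (edgeCode (φ i) F) := by
      intro i hi
      rw [hval i hi, List.sum_eq_zero_iff]
      simp only [List.mem_map, forall_exists_index, and_imp, forall_apply_eq_imp_iff₂,
        ite_eq_right_iff, one_ne_zero, imp_false, ← hqF]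
    have hle : ∀ i < m, entrySum data q (selected data q (3 + i * s)) ≤ f := by
      intro i hi
      rw [hval i hi]
      refine (List.sum_le_card_nsmul _ 1 fun x hx => ?_).trans (by simpa using hqlen)
      obtain ⟨e, _, rfl⟩ := List.mem_map.1 hx
      split_ifs <;> omega
    obtain ⟨σ, hσ, hout⟩ := exec_queryProg (w := w) (m := m) hd0 hd1 hd2 (by positivity)
      (q := q) (by omega) (by omega) hwD
      (fun i hi => by rw [hsel i hi]; exact (hbound i hi _ (hlt i)).trans_lt hwD)
      (fun i hi => by rw [hsum i hi]; have := hlt i; omega)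
      (fun i hi => by have := hle i hi; omega)
    -- The candidate graph of each function; the answer keeps those that pass the test, in the order
    -- of the blocks.
    let g : Fin m → Fin (codeRPC (m := m) G φ hφ).size := fun i =>
      ⟨M * i + edgeCode (φ i) F, by
        have h1 := hlt i
        have h2 := i.2
        change _ < m * M
        nlinarith⟩
    have gdiv : ∀ i : Fin m, (g i : ℕ) / M = i := fun i => by
      simp only [g]
      rw [Nat.mul_add_div hMpos, Nat.div_eq_of_lt (hlt i), add_zero]
    have gmod : ∀ i : Fin m, (g i : ℕ) % M = edgeCode (φ i) F := fun i => by
      simp only [g]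
      rw [Nat.mul_add_mod, Nat.mod_eq_of_lt (hlt i)]
    have ginj : Function.Injective g := fun i j h => by
      apply Fin.ext
      rw [← gdiv i, ← gdiv j, h]
    refine ⟨((List.finRange m).filter fun i : Fin m =>
      entrySum data q (selected data q (3 + (i : ℕ) * s)) = 0).map g, σ, _, ?_, ?_, hσ, ?_, ?_⟩
    · exact ((List.nodup_finRange m).filter _).map ginj
    · intro j
      simp only [List.mem_map, List.mem_filter, List.mem_finRange, true_and, decide_eq_true_eq]
      have hsub : j ∈ (codeRPC (m := m) G φ hφ).sub F ↔
          (j : ℕ) % M = edgeCode (φ (j / M)) F ∧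
            ∀ e ∈ F, e ∉ codeGraph G (φ (j / M)) (j % M) :=
        ⟨fun h => (Finset.mem_filter.1 h).2,
          fun h => Finset.mem_filter.2 ⟨Finset.mem_univ _, h⟩⟩
      rw [hsub]
      constructor
      · rintro ⟨i, hi, rfl⟩
        rw [gdiv, gmod]
        exact ⟨rfl, (hzero i i.2).1 hi⟩
      · rintro ⟨h1, h2⟩
        refine ⟨⟨j / M, hdivlt j⟩, (hzero _ (hdivlt j)).2 (by rwa [h1] at h2), ?_⟩
        apply Fin.ext
        change M * (j / M) + edgeCode (φ (j / M)) F = j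
        rw [← h1, Nat.div_add_mod]
    · rw [hout, ← List.map_coe_finRange_eq_range, List.filter_map, List.map_map, List.map_map]
      refine List.map_congr_left fun i _ => ?_
      simp only [Function.comp, loc, gdiv, gmod]
      rw [hsel i i.2]
    · have : m * (20 * q.length + 13) + 9 ≤ m * (20 * f + 13) + 9 := by gcongr
      exact_mod_cast this

end Covering

/-! ### Choice of the number of functions and the asymptotics -/

section Bounds

theorem HasCovering.mono {k : EdgeKind} {n L f : ℕ} {G : WGraph k n} {P : Prog} {c : ℕ}
    {cov cov' qt qt' sz sz' : ℝ} (h : HasCovering G L f P c cov qt sz) (h1 : cov ≤ cov')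
    (h2 : qt ≤ qt') (h3 : sz ≤ sz') : HasCovering G L f P c cov' qt' sz' := by
  obtain ⟨C, w, data, loc, g1, g2, g3, g4, g5, g6, g7, g8⟩ := h
  refine ⟨C, w, data, loc, g1.trans h1, fun F hF hc => (g2 F hF hc).trans h3,
    g3.trans (by gcongr), g4, g5, g6, g7, fun F hF hc q hq hqF => ?_⟩
  obtain ⟨ids, σ, t, a1, a2, a3, a4, a5⟩ := g8 F hF hc q hq hqF
  exact ⟨ids, σ, t, a1, a2, a3, a4, a5.trans h2⟩

theorem one_le_log {n : ℕ} (hn : 3 ≤ n) : 1 ≤ Real.log n := by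
  rw [Real.le_log_iff_exp_le (by positivity)]
  have : (3 : ℝ) ≤ n := by exact_mod_cast hn
  linarith [Real.exp_one_lt_three]

theorem hasCovering {k : EdgeKind} {n f L : ℕ} (G : WGraph k n) (hn : 3 ≤ n) (hf : 0 < f)
    (hL : 0 < L) :
    HasCovering G L f queryProg 2
      (60 * f * Real.exp (3 * f) * (L : ℝ) ^ f * Real.log n)
      (600 * f ^ 2 * Real.exp f * Real.log n)
      (12 * f * Real.exp f * Real.log n) := by
  have hlog := one_le_log hn
  have hf1 : (1 : ℝ) ≤ f := by exact_mod_cast hf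
  have hL1 : (1 : ℝ) ≤ L := by exact_mod_cast hL
  have hn3 : (3 : ℝ) ≤ n := by exact_mod_cast hn
  have hexp : 1 ≤ Real.exp f := Real.one_le_exp (by positivity)
  have hfexp : (f : ℝ) ≤ Real.exp f := by linarith [Real.add_one_le_exp (f : ℝ)]
  set x : ℝ := f * Real.exp f * Real.log n with hx
  have hx1 : 1 ≤ x := one_le_mul_of_one_le_of_one_le
    (one_le_mul_of_one_le_of_one_le hf1 hexp) hlog
  -- `10 * x` makes the exponent `exp (-f) / 2 * m` exceed `5 * f * log n`, which beats the `n ^ (5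
  -- * f)` triples. Rounding up costs at most `2 ≤ 2 * x`.
  obtain ⟨m, hmpos, hm1, hm2⟩ : ∃ m : ℕ, 0 < m ∧ 10 * x < m ∧ (m : ℝ) ≤ 12 * x := by
    refine ⟨⌈10 * x⌉₊ + 1, Nat.succ_pos _, ?_, ?_⟩ <;> push_cast
    · linarith [Nat.le_ceil (10 * x)]
    · linarith [Nat.ceil_lt_add_one (by linarith : 0 ≤ 10 * x)]
  have hcount : (((n : ℝ) ^ 2 + 1) ^ f * (n : ℝ) ^ 2) < Real.exp (Real.exp (-f) / 2 * m) := by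
    have h1 : ((n : ℝ) ^ 2 + 1) ≤ (n : ℝ) ^ 3 := by nlinarith [sq_nonneg ((n : ℝ))]
    calc (((n : ℝ) ^ 2 + 1) ^ f * (n : ℝ) ^ 2) ≤ ((n : ℝ) ^ 3) ^ f * (n : ℝ) ^ 2 := by gcongr
      _ = (n : ℝ) ^ (3 * f + 2) := by rw [← pow_mul, ← pow_add]
      _ ≤ (n : ℝ) ^ (5 * f) := pow_le_pow_right₀ (by linarith) (by omega)
      _ = Real.exp (5 * f * Real.log n) := by
        rw [show 5 * f * Real.log n = ((5 * f : ℕ) : ℝ) * Real.log n by push_cast; ring,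
          Real.exp_nat_mul, Real.exp_log (by positivity)]
      _ < Real.exp (Real.exp (-f) / 2 * m) := by
        rw [Real.exp_lt_exp]
        calc 5 * f * Real.log n = Real.exp (-f) / 2 * (10 * x) := by
              rw [hx, Real.exp_neg]; field_simp; ring
          _ < _ := by have := Real.exp_pos (-(f : ℝ)); gcongr
  obtain ⟨φ, hφ⟩ := exists_separating_paths G hf hL hcount
  refine (hasCovering_of_separating G (by omega) hf hmpos φ hφ).mono ?_ ?_ ?_
  -- The three factors `exp f` come from `m`, from `2 ^ f`, and from the estimate `f ≤ exp f` for
  -- the factor `f` in `graphCount`.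
  · have h2 : (2 : ℝ) ^ f ≤ Real.exp f := by
      rw [← Real.exp_one_pow]
      exact pow_le_pow_left₀ (by norm_num) (by linarith [Real.add_one_le_exp (1 : ℝ)]) _
    have hLf : 1 ≤ (L : ℝ) ^ f := one_le_pow₀ hL1
    have h3 : (1 : ℝ) ≤ f * (Real.exp f * (L : ℝ) ^ f) :=
      one_le_mul_of_one_le_of_one_le hf1 (one_le_mul_of_one_le_of_one_le hexp hLf)
    have h4 : (f : ℝ) * (2 * L) ^ f ≤ f * (Real.exp f * (L : ℝ) ^ f) := by
      rw [mul_pow]; gcongr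
    rw [graphCount]
    push_cast
    rw [show (3 : ℝ) * f = f + f + f by ring, Real.exp_add, Real.exp_add]
    calc (m : ℝ) * (f * (2 * L) ^ f + 1 + 2)
        ≤ 12 * x * (5 * (Real.exp f * (Real.exp f * (L : ℝ) ^ f))) := by
          gcongr
          calc (f : ℝ) * (2 * L) ^ f + 1 + 2 ≤ 5 * (f * (Real.exp f * (L : ℝ) ^ f)) := by linarith
            _ ≤ _ := by gcongr
      _ = _ := by rw [hx]; ring
  · push_cast
    have h1 : (1 : ℝ) ≤ x * f := one_le_mul_of_one_le_of_one_le hx1 hf1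
    calc (m : ℝ) * (20 * f + 13) + 9 ≤ 12 * x * (20 * f + 13 * f) + 9 * (x * f) := by
          gcongr <;> linarith
      _ ≤ 600 * (x * f) := by linarith
      _ = _ := by rw [hx]; ring
  · rw [hx] at hm2
    linarith

end Bounds

theorem theorem1 :
    ∃ (P : Prog) (c : ℕ) (A : ℝ),
      (∀ f L : ℕ → ℕ, (∀ n, 0 < f n) → (∀ n, 0 < L n) →
        (fun n => (f n : ℝ)) =o[atTop] (fun n => Real.log (L n : ℝ)) →
        ∃ ε : ℕ → ℝ, Tendsto ε atTop (𝓝 0) ∧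
          ∀ᶠ n : ℕ in atTop, ∀ (k : EdgeKind) (G : WGraph k n),
            HasCovering G (L n) (f n) P c
              (A * (f n : ℝ) * (L n : ℝ) ^ ((f n : ℝ) + ε n) * Real.log (n : ℝ) ^ c)
              (A * (f n : ℝ) ^ ((5 : ℝ) / 2) * (L n : ℝ) ^ ε n * Real.log (n : ℝ) ^ c)
              (A * (f n : ℝ) * (L n : ℝ) ^ ε n * Real.log (n : ℝ) ^ c)) ∧
      (∀ f L : ℕ → ℕ, (∀ n, 0 < f n) → (∀ n, 0 < L n) →
        (fun n => (f n : ℝ)) =o[atTop] (fun n => Real.log (n : ℝ)) →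
        ∃ ε : ℕ → ℝ, Tendsto ε atTop (𝓝 0) ∧
          ∀ᶠ n : ℕ in atTop, ∀ (k : EdgeKind) (G : WGraph k n),
            HasCovering G (L n) (f n) P c
              ((L n : ℝ) ^ f n * (n : ℝ) ^ ε n)
              ((n : ℝ) ^ ε n)
              ((n : ℝ) ^ ε n)) := by
  refine ⟨queryProg, 2, 600, fun f L hf hL ho => ?_, fun f L hf hL ho => ?_⟩
  -- Chosen so that `L ^ ε = exp (3 * f)`.
  · refine ⟨fun n => 3 * (f n / Real.log (L n)), by simpa using ho.tendsto_div_nhds_zero.const_mul 3,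
      ?_⟩
    filter_upwards [eventually_ge_atTop 3, ho.bound (show (0 : ℝ) < 1 by norm_num)]
      with n hn hb k G
    have hlog := one_le_log hn
    have hf1 : (1 : ℝ) ≤ f n := by exact_mod_cast hf n
    have hL0 : (0 : ℝ) < L n := by exact_mod_cast hL n
    -- The little-o bound with constant `1` gives `1 ≤ f ≤ log L`.
    have hlogL : 0 < Real.log (L n) := by
      have h0 : 0 ≤ Real.log (L n) := Real.log_natCast_nonneg _
      rw [Real.norm_of_nonneg h0, Real.norm_of_nonneg (by positivity)] at hb
      linarith
    have hpow : (L n : ℝ) ^ (3 * (f n / Real.log (L n))) = Real.exp (3 * f n) := by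
      rw [Real.rpow_def_of_pos hL0]
      congr 1
      field_simp
    have hexp : Real.exp (f n) ≤ Real.exp (3 * f n) := Real.exp_le_exp.2 (by linarith)
    have hlog2 : Real.log n ≤ Real.log n ^ 2 := by nlinarith
    have hsq : (f n : ℝ) ^ 2 ≤ (f n : ℝ) ^ ((5 : ℝ) / 2) := by
      rw [← Real.rpow_natCast]
      exact Real.rpow_le_rpow_of_exponent_le hf1 (by norm_num)
    refine (hasCovering G hn (hf n) (hL n)).mono ?_ ?_ ?_
    · rw [Real.rpow_add hL0, hpow, Real.rpow_natCast]
      calc 60 * (f n : ℝ) * Real.exp (3 * f n) * (L n : ℝ) ^ f n * Real.log n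
          ≤ 600 * (f n : ℝ) * Real.exp (3 * f n) * (L n : ℝ) ^ f n * Real.log n ^ 2 := by
            gcongr; norm_num
        _ = _ := by ring
    · rw [hpow]
      gcongr
    · rw [hpow]
      gcongr
      norm_num
  · have hll : Tendsto (fun n : ℕ => Real.log (Real.log n) / Real.log n) atTop (𝓝 0) :=
      Real.isLittleO_log_id_atTop.tendsto_div_nhds_zero.comp
        (Real.tendsto_log_atTop.comp tendsto_natCast_atTop_atTop)
    -- Chosen so that `n ^ ε = exp (11 * f) * log n`. For the covering value, `7 + 1 + 3` pays for
    -- the constant, the factor `f` and `exp (3 * f)`.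
    refine ⟨fun n => 11 * (f n / Real.log n) + Real.log (Real.log n) / Real.log n,
      by simpa using (ho.tendsto_div_nhds_zero.const_mul 11).add hll, ?_⟩
    filter_upwards [eventually_ge_atTop 3] with n hn k G
    have hlog := one_le_log hn
    have hf1 : (1 : ℝ) ≤ f n := by exact_mod_cast hf n
    have hn0 : (0 : ℝ) < n := by positivity
    have hpow : (n : ℝ) ^ (11 * (f n / Real.log n) + Real.log (Real.log n) / Real.log n)
        = Real.exp (11 * f n) * Real.log n := by
      rw [Real.rpow_def_of_pos hn0, show Real.log n * (11 * (f n / Real.log n) +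
        Real.log (Real.log n) / Real.log n) = 11 * f n + Real.log (Real.log n) by field_simp,
        Real.exp_add, Real.exp_log (by linarith)]
    have hfexp : (f n : ℝ) ≤ Real.exp (f n) := by linarith [Real.add_one_le_exp (f n : ℝ)]
    have h600 : (600 : ℝ) ≤ Real.exp (7 * f n) := by
      calc (600 : ℝ) ≤ 2.7 ^ 7 := by norm_num
        _ ≤ Real.exp 1 ^ 7 := by gcongr; linarith [Real.exp_one_gt_d9]
        _ = Real.exp 7 := by rw [← Real.exp_nat_mul]; norm_num
        _ ≤ _ := Real.exp_le_exp.2 (by linarith)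
    have hsplit : Real.exp (11 * f n) =
        Real.exp (7 * f n) * Real.exp (f n) * Real.exp (3 * f n) := by
      rw [← Real.exp_add, ← Real.exp_add]; ring_nf
    have hsplit' : Real.exp (3 * f n) = Real.exp (f n) ^ 2 * Real.exp (f n) := by
      rw [← Real.exp_nat_mul, ← Real.exp_add]; push_cast; ring_nf
    have he1 : 1 ≤ Real.exp (f n) := Real.one_le_exp (by positivity)
    refine (hasCovering G hn (hf n) (hL n)).mono ?_ ?_ ?_
    · rw [hpow, hsplit]
      calc 60 * (f n : ℝ) * Real.exp (3 * f n) * (L n : ℝ) ^ f n * Real.log n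
          ≤ Real.exp (7 * f n) * Real.exp (f n) * Real.exp (3 * f n) * (L n : ℝ) ^ f n *
            Real.log n := by gcongr; linarith
        _ = _ := by ring
    · rw [hpow, hsplit, hsplit']
      calc 600 * (f n : ℝ) ^ 2 * Real.exp (f n) * Real.log n
          ≤ Real.exp (7 * f n) * Real.exp (f n) ^ 2 * Real.exp (f n) * Real.log n := by gcongr
        _ ≤ Real.exp (f n) * (Real.exp (7 * f n) * Real.exp (f n) ^ 2 * Real.exp (f n) *
            Real.log n) := le_mul_of_one_le_left (by positivity) he1
        _ = _ := by ring
    · rw [hpow, hsplit, hsplit']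
      calc 12 * (f n : ℝ) * Real.exp (f n) * Real.log n
          ≤ Real.exp (7 * f n) * Real.exp (f n) * (Real.exp (f n) ^ 2 * Real.exp (f n)) *
            Real.log n := by
            gcongr
            · linarith
            · exact le_mul_of_one_le_left (by positivity) (one_le_pow₀ he1)
        _ = _ := rfl
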